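/- Let $(\mathcal H,[\cdot,\cdot])$ be a Krein space with associated Hilbert space inner product $(\cdot,\cdot)$, and let $\mathcal F=\{f_i\}_{i\in I}$ be a $J$-frame for $\mathcal H$: $\mathcal F$ is a frame for $(\mathcal H,(\cdot,\cdot))$ and, with $I_+=\{i:[f_i,f_i]\ge 0\}$, $I_-=\{i:[f_i,f_i]<0\}$ and $\mathcal M_\pm=\overline{\operatorname{span}}\{f_i:i\in I_\pm\}$, the subspaces $\mathcal M_\pm$ are non-degenerate and there are constants $0<\alpha_\pm\le\beta_\pm$ with $$\alpha_\pm(\pm[f,f])\le\sum_{i\in I_\pm}|[f,f_i]|^2\le\beta_\pm(\pm[f,f]),\qquad f\in\mathcal M_\pm .$$ Let $S$ be its $J$-frame operator, $Sf=\sum_{i\in I_+}[f,f_i]f_i-\sum_{i\in I_-}[f,f_i]f_i$ for $f\in\mathcal H$. Then $S$ is boundedly invertible and the following hold, where $\mathcal B_r(a)\subseteq\mathbb C$ is the closed disc with centre $a$ and radius $r$. (i) $\mathcal H=\mathcal M_-^{[\perp]}\,[\dotplus]\,\mathcal M_-$ is a fundamental decomposition, and with respect to it $$S=\begin{pmatrix}A&-AK\\K^*A&D\end{pmatrix}$$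 with $A$ uniformly positive, $\|K\|<1$, $D$ self-adjoint and $D+K^*AK$ uniformly positive (norms and adjoints with respect to the Hilbert spaces $(\mathcal M_-^{[\perp]},[\cdot,\cdot])$ and $(\mathcal M_-,-[\cdot,\cdot])$). (ii) $\mathcal H=\mathcal M_+\,[\dotplus]\,\mathcal M_+^{[\perp]}$ is a fundamental decomposition, and with respect to it $$S=\begin{pmatrix}A'&LD'\\-D'L^*&D'\end{pmatrix}$$ with $D'$ uniformly positive, $\|L\|<1$, $A'$ self-adjoint and $A'+LD'L^*$ uniformly positive (norms and adjoints with respect to $(\mathcal M_+,[\cdot,\cdot])$ and $(\mathcal M_+^{[\perp]},-[\cdot,\cdot])$). Let $K$ and $L$ be the angular operators in (i) and (ii). Let $\alpha_\pm,\beta_\pm$ be the $J$-frame bounds of $\mathcal F$, i.e. the optimal constants in the inequalities above, and let $\gamma_\pm,\delta_\pm$ be those of the canonical dual $J$-frame $\{S^{-1}f_i\}_{i\in I}$, i.e. the optimal constants with $$\gamma_\pm(\pm[f,f])\le\sum_{i\in I_\pm}|[f,S^{-1}f_i]|^2\le\delta_\pm(\pm[f,f]),\qquad f\in\mathcal M_\mp^{[\perp]},$$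 where in (iii) and (iv) the bounds that occur there are assumed to exist (optimal constants exist unless the subspace in question is $\{0\}$). (iii) We have $$\sigma(S)\setminus\mathbb R\subseteq\Bigl(\bigcup_{a\in[\delta_+^{-1},\gamma_+^{-1}]}\mathcal B_{a\|K\|}(a)\Bigr)\cap\Bigl(\bigcup_{b\in[\alpha_-,\beta_-]}\mathcal B_{\frac{b\|K\|}{1-\|K\|^2}}\bigl(\tfrac{b}{1-\|K\|^2}\bigr)\Bigr),$$ and the right-hand side is contained in the sector $\{z\in\mathbb C:\operatorname{Re}z>0,\ |\operatorname{Im}z|\le\tan\varphi\cdot\operatorname{Re}z\}$ with $\varphi=\arcsin\|K\|$. (iv) We have $$\sigma(S)\setminus\mathbb R\subseteq\Bigl(\bigcup_{d\in[\delta_-^{-1},\gamma_-^{-1}]}\mathcal B_{d\|L\|}(d)\Bigr)\cap\Bigl(\bigcup_{b\in[\alpha_+,\beta_+]}\mathcal B_{\frac{b\|L\|}{1-\|L\|^2}}\bigl(\tfrac{b}{1-\|L\|^2}\bigr)\Bigr),$$ and the right-hand side is contained in the same sector with $\varphi=\arcsin\|L\|$. -/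

import Mathlib

open scoped ComplexConjugate

noncomputable section

namespace Krein

universe u v

/-- A Krein space, presented as a complex Hilbert space `(H, (·,·))` together with a fundamental
symmetry, i.e. a unitary self-adjoint operator (equivalently: a self-adjoint involution).
The Hilbert space structure is one of those induced by the fundamental decompositions; it is used
only for the topology of `H` and for the notion of a frame, which do not depend on the choice. -/
structure FundamentalSymmetry (H : Type u) [NormedAddCommGroup H] [InnerProductSpace ℂ H]
    [CompleteSpace H] where
  op : H →L[ℂ] H
  isSelfAdjoint : IsSelfAdjoint op
  mul_self : op * op = 1

variable {H : Type u} [NormedAddCommGroup H] [InnerProductSpace ℂ H] [CompleteSpace H]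

/-- The indefinite inner product `[x, y] = (J x, y)`, linear in `x`, conjugate linear in `y`
(Mathlib's `inner` is conjugate linear in the first argument). -/
def form (J : FundamentalSymmetry H) (x y : H) : ℂ := inner ℂ y (J.op x)

theorem form_add_left (J : FundamentalSymmetry H) (x y z : H) :
    form J (x + y) z = form J x z + form J y z := by
  simp [form]

theorem form_smul_left (J : FundamentalSymmetry H) (c : ℂ) (x y : H) :
    form J (c • x) y = c * form J x y := by
  simp [form]

theorem form_conj (J : FundamentalSymmetry H) (x y : H) :
    conj (form J x y) = form J y x := by
  have h := (ContinuousLinearMap.isSelfAdjoint_iff_isSymmetric.mp J.isSelfAdjoint) x y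
  simp only [ContinuousLinearMap.coe_coe] at h
  simp only [form]
  rw [inner_conj_symm, h]

/-- The orthogonal subspace `M^[⊥]`. -/
def orth (J : FundamentalSymmetry H) (M : Submodule ℂ H) : Submodule ℂ H where
  carrier := {x | ∀ s ∈ M, form J x s = 0}
  add_mem' := by
    intro a b ha hb s hs
    rw [form_add_left, ha s hs, hb s hs, add_zero]
  zero_mem' := by
    intro s _
    simp [form]
  smul_mem' := by
    intro c x hx s hs
    rw [form_smul_left, hx s hs, mul_zero]

/-- A subspace `M` is non-degenerate if `M ∩ M^[⊥] = {0}`. -/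
def Nondegenerate (J : FundamentalSymmetry H) (M : Submodule ℂ H) : Prop :=
  M ⊓ orth J M = ⊥

/-! ### Fundamental decompositions -/

/-- A subspace of `H` which is a Hilbert space with respect to `s [·,·]` (used with `s = 1` and
`s = -1`): the form `s [·,·]` is positive definite on it, and every Cauchy sequence for the norm
`√(s [x,x])` converges in it for this norm. -/
structure HilbertSubspace (J : FundamentalSymmetry H) (s : ℝ) where
  space : Submodule ℂ H
  pos : ∀ x ∈ space, x ≠ 0 → 0 < s * (form J x x).re
  complete : ∀ w : ℕ → H, (∀ n, w n ∈ space) →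
    (∀ ε > 0, ∃ N, ∀ m ≥ N, ∀ n ≥ N, √(s * (form J (w m - w n) (w m - w n)).re) < ε) →
    ∃ x ∈ space, ∀ ε > 0, ∃ N, ∀ n ≥ N, √(s * (form J (w n - x) (w n - x)).re) < ε

/-- The underlying vector space of a `HilbertSubspace`, to be equipped with the inner product
`s [·,·]` (and not with the restriction of the inner product of `H`). -/
def HilbertSubspace.Carrier {J : FundamentalSymmetry H} {s : ℝ} (P : HilbertSubspace J s) :
    Type u := P.space

instance {J : FundamentalSymmetry H} {s : ℝ} (P : HilbertSubspace J s) :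
    AddCommGroup P.Carrier := inferInstanceAs (AddCommGroup P.space)

instance {J : FundamentalSymmetry H} {s : ℝ} (P : HilbertSubspace J s) :
    Module ℂ P.Carrier := inferInstanceAs (Module ℂ P.space)

/-- The inclusion into `H`, as a linear map. -/
def HilbertSubspace.incl {J : FundamentalSymmetry H} {s : ℝ} (P : HilbertSubspace J s) :
    P.Carrier →ₗ[ℂ] H := P.space.subtype

theorem HilbertSubspace.incl_mem {J : FundamentalSymmetry H} {s : ℝ} (P : HilbertSubspace J s)
    (x : P.Carrier) : P.incl x ∈ P.space := Subtype.property (p := (· ∈ P.space)) x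

theorem HilbertSubspace.incl_injective {J : FundamentalSymmetry H} {s : ℝ}
    (P : HilbertSubspace J s) : Function.Injective P.incl := P.space.injective_subtype

/-- The inner product of the carrier, `s [·,·]`, in Mathlib's order of arguments. -/
@[reducible] def HilbertSubspace.core {J : FundamentalSymmetry H} {s : ℝ} (P : HilbertSubspace J s) :
    InnerProductSpace.Core ℂ P.Carrier where
  inner x y := (s : ℂ) * form J (P.incl y) (P.incl x)
  conj_inner_symm x y := by
    rw [map_mul, form_conj, Complex.conj_ofReal]
  re_inner_nonneg x := by
    by_cases hx : P.incl x = 0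
    · simp [hx, form]
    · have h := P.pos _ (P.incl_mem x) hx
      simpa using h.le
  add_left x y z := by
    rw [← form_conj J (P.incl (x + y)), ← form_conj J (P.incl x), ← form_conj J (P.incl y),
      map_add, form_add_left, map_add, mul_add]
  smul_left x y c := by
    rw [← form_conj J (P.incl (c • x)), ← form_conj J (P.incl x), map_smul, form_smul_left,
      map_mul]
    ring
  definite x hx := by
    by_contra h
    have h' : P.incl x ≠ 0 := fun h0 => h (P.incl_injective (by rw [h0, map_zero]))
    have h2 := P.pos _ (P.incl_mem x) h'
    have h3 := congrArg Complex.re hx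
    simp only [Complex.re_ofReal_mul, Complex.zero_re] at h3
    exact h2.ne' h3

instance {J : FundamentalSymmetry H} {s : ℝ} (P : HilbertSubspace J s) :
    NormedAddCommGroup P.Carrier :=
  @InnerProductSpace.Core.toNormedAddCommGroup ℂ P.Carrier _ _ _ P.core

instance {J : FundamentalSymmetry H} {s : ℝ} (P : HilbertSubspace J s) :
    InnerProductSpace ℂ P.Carrier :=
  InnerProductSpace.ofCore P.core.toCore

theorem HilbertSubspace.inner_eq {J : FundamentalSymmetry H} {s : ℝ} (P : HilbertSubspace J s)
    (x y : P.Carrier) : inner ℂ x y = (s : ℂ) * form J (P.incl y) (P.incl x) := rfl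

theorem HilbertSubspace.norm_eq {J : FundamentalSymmetry H} {s : ℝ} (P : HilbertSubspace J s)
    (x : P.Carrier) : ‖x‖ = √(s * (form J (P.incl x) (P.incl x)).re) := by
  rw [@norm_eq_sqrt_re_inner ℂ, P.inner_eq]
  simp

instance {J : FundamentalSymmetry H} {s : ℝ} (P : HilbertSubspace J s) :
    CompleteSpace P.Carrier := by
  refine Metric.complete_of_cauchySeq_tendsto fun w hw => ?_
  rw [Metric.cauchySeq_iff] at hw
  obtain ⟨x, hx, hlim⟩ := P.complete (fun n => P.incl (w n)) (fun n => P.incl_mem _) (by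
    intro ε hε
    obtain ⟨N, hN⟩ := hw ε hε
    refine ⟨N, fun m hm n hn => ?_⟩
    have h := hN m hm n hn
    rwa [dist_eq_norm, P.norm_eq, map_sub] at h)
  let x' : P.Carrier := (⟨x, hx⟩ : P.space)
  have hx' : P.incl x' = x := rfl
  refine ⟨x', Metric.tendsto_atTop.mpr fun ε hε => ?_⟩
  obtain ⟨N, hN⟩ := hlim ε hε
  refine ⟨N, fun n hn => ?_⟩
  rw [dist_eq_norm, P.norm_eq, map_sub, hx']
  exact hN n hn

/-- A fundamental decomposition `H = H₊ [∔] H₋`: a direct sum, orthogonal with respect to `[·,·]`,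
such that `(H₊, [·,·])` and `(H₋, -[·,·])` are Hilbert spaces. -/
structure FundamentalDecomposition (J : FundamentalSymmetry H) where
  plus : HilbertSubspace J 1
  minus : HilbertSubspace J (-1)
  isCompl : IsCompl plus.space minus.space
  orthogonal : ∀ x ∈ plus.space, ∀ y ∈ minus.space, form J x y = 0

/-- Uniformly positive operators in a Hilbert space. -/
def UniformlyPositive {E : Type u} [NormedAddCommGroup E] [InnerProductSpace ℂ E]
    [CompleteSpace E] (T : E →L[ℂ] E) : Prop :=
  IsSelfAdjoint T ∧ ∃ c : ℝ, 0 < c ∧ ∀ x, c * ‖x‖ ^ 2 ≤ (inner ℂ x (T x)).re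

/-- With respect to the fundamental decomposition `H = H₊ [∔] H₋`, the operator `S` is the block
operator matrix `[A, -A K; K* A, D]` with `A` uniformly positive, `‖K‖ < 1`, `D` self-adjoint and
`D + K* A K` uniformly positive. Norms and adjoints are those of the Hilbert spaces
`(H₊, [·,·])` and `(H₋, -[·,·])`. -/
structure RepresentedWithK {J : FundamentalSymmetry H} (𝒟 : FundamentalDecomposition J)
    (S : H →L[ℂ] H) (A : 𝒟.plus.Carrier →L[ℂ] 𝒟.plus.Carrier)
    (K : 𝒟.minus.Carrier →L[ℂ] 𝒟.plus.Carrier)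
    (D : 𝒟.minus.Carrier →L[ℂ] 𝒟.minus.Carrier) : Prop where
  matrix : ∀ x y, S (𝒟.plus.incl x + 𝒟.minus.incl y) =
    𝒟.plus.incl (A x - A (K y)) +
      𝒟.minus.incl (ContinuousLinearMap.adjoint K (A x) + D y)
  uniformlyPositive : UniformlyPositive A
  norm_lt_one : ‖K‖ < 1
  isSelfAdjoint : IsSelfAdjoint D
  uniformlyPositive_schur :
    UniformlyPositive (D + (ContinuousLinearMap.adjoint K).comp (A.comp K))

/-- With respect to the fundamental decomposition `H = K₊ [∔] K₋`, the operator `S` is the block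
operator matrix `[A, L D; -D L*, D]` with `D` uniformly positive, `‖L‖ < 1`, `A` self-adjoint and
`A + L D L*` uniformly positive. -/
structure RepresentedWithL {J : FundamentalSymmetry H} (𝒟 : FundamentalDecomposition J)
    (S : H →L[ℂ] H) (A : 𝒟.plus.Carrier →L[ℂ] 𝒟.plus.Carrier)
    (L : 𝒟.minus.Carrier →L[ℂ] 𝒟.plus.Carrier)
    (D : 𝒟.minus.Carrier →L[ℂ] 𝒟.minus.Carrier) : Prop where
  matrix : ∀ x y, S (𝒟.plus.incl x + 𝒟.minus.incl y) =
    𝒟.plus.incl (A x + L (D y)) +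
      𝒟.minus.incl (-D (ContinuousLinearMap.adjoint L x) + D y)
  uniformlyPositive : UniformlyPositive D
  norm_lt_one : ‖L‖ < 1
  isSelfAdjoint : IsSelfAdjoint A
  uniformlyPositive_schur :
    UniformlyPositive (A + L.comp (D.comp (ContinuousLinearMap.adjoint L)))

/-! ### J-frames -/

variable {ι : Type v}

/-- A frame for the Hilbert space `H`. -/
def IsFrame (f : ι → H) : Prop :=
  ∃ α β : ℝ, 0 < α ∧ α ≤ β ∧ ∀ x : H, Summable (fun i => ‖inner ℂ (f i) x‖ ^ 2) ∧
    α * ‖x‖ ^ 2 ≤ ∑' i, ‖inner ℂ (f i) x‖ ^ 2 ∧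
    ∑' i, ‖inner ℂ (f i) x‖ ^ 2 ≤ β * ‖x‖ ^ 2

/-- `I₊ = {i : [f i, f i] ≥ 0}` (the number `[x, x]` is always real). -/
def posIdx (J : FundamentalSymmetry H) (f : ι → H) : Set ι := {i | 0 ≤ (form J (f i) (f i)).re}

/-- `I₋ = {i : [f i, f i] < 0}`. -/
def negIdx (J : FundamentalSymmetry H) (f : ι → H) : Set ι := {i | (form J (f i) (f i)).re < 0}

/-- `M₊`, the closed linear span of the `f i` with `i ∈ I₊`. -/
def spanPos (J : FundamentalSymmetry H) (f : ι → H) : Submodule ℂ H :=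
  (Submodule.span ℂ (f '' posIdx J f)).topologicalClosure

/-- `M₋`, the closed linear span of the `f i` with `i ∈ I₋`. -/
def spanNeg (J : FundamentalSymmetry H) (f : ι → H) : Submodule ℂ H :=
  (Submodule.span ℂ (f '' negIdx J f)).topologicalClosure

/-- `a (s [x,x]) ≤ ∑ |[x, g i]|²` for all `x ∈ M`. -/
def IsLowerFrameBound (J : FundamentalSymmetry H) (s : ℝ) {κ : Type v} (g : κ → H)
    (M : Submodule ℂ H) (a : ℝ) : Prop :=
  0 < a ∧ ∀ x ∈ M, Summable (fun i => ‖form J x (g i)‖ ^ 2) ∧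
    a * (s * (form J x x).re) ≤ ∑' i, ‖form J x (g i)‖ ^ 2

/-- `∑ |[x, g i]|² ≤ b (s [x,x])` for all `x ∈ M`. -/
def IsUpperFrameBound (J : FundamentalSymmetry H) (s : ℝ) {κ : Type v} (g : κ → H)
    (M : Submodule ℂ H) (b : ℝ) : Prop :=
  0 < b ∧ ∀ x ∈ M, Summable (fun i => ‖form J x (g i)‖ ^ 2) ∧
    ∑' i, ‖form J x (g i)‖ ^ 2 ≤ b * (s * (form J x x).re)

/-- `a` and `b` are the optimal constants with
`a (s [x,x]) ≤ ∑ |[x, g i]|² ≤ b (s [x,x])` for all `x ∈ M`. -/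
def IsOptimalFrameBounds (J : FundamentalSymmetry H) (s : ℝ) {κ : Type v} (g : κ → H)
    (M : Submodule ℂ H) (a b : ℝ) : Prop :=
  IsGreatest {a' | IsLowerFrameBound J s g M a'} a ∧ IsLeast {b' | IsUpperFrameBound J s g M b'} b

/-- J-frames. -/
structure IsJFrame (J : FundamentalSymmetry H) (f : ι → H) : Prop where
  isFrame : IsFrame f
  nondegenerate_pos : Nondegenerate J (spanPos J f)
  nondegenerate_neg : Nondegenerate J (spanNeg J f)
  bounds_pos : ∃ α β : ℝ, α ≤ β ∧
    IsLowerFrameBound J 1 (fun i : posIdx J f => f i) (spanPos J f) α ∧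
    IsUpperFrameBound J 1 (fun i : posIdx J f => f i) (spanPos J f) β
  bounds_neg : ∃ α β : ℝ, α ≤ β ∧
    IsLowerFrameBound J (-1) (fun i : negIdx J f => f i) (spanNeg J f) α ∧
    IsUpperFrameBound J (-1) (fun i : negIdx J f => f i) (spanNeg J f) β

/-- `α` and `β` are the J-frame bounds `α₊`, `β₊` of `f`. -/
def IsJFrameBoundsPos (J : FundamentalSymmetry H) (f : ι → H) (α β : ℝ) : Prop :=
  IsOptimalFrameBounds J 1 (fun i : posIdx J f => f i) (spanPos J f) α β

/-- `α` and `β` are the J-frame bounds `α₋`, `β₋` of `f`. -/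
def IsJFrameBoundsNeg (J : FundamentalSymmetry H) (f : ι → H) (α β : ℝ) : Prop :=
  IsOptimalFrameBounds J (-1) (fun i : negIdx J f => f i) (spanNeg J f) α β

/-- `S x = ∑_{I₊} [x, f i] f i - ∑_{I₋} [x, f i] f i` for all `x`. -/
def IsJFrameOperator (J : FundamentalSymmetry H) (f : ι → H) (S : H →L[ℂ] H) : Prop :=
  ∀ x, ∃ p q : H, HasSum (fun i : posIdx J f => form J x (f i) • f i) p ∧
    HasSum (fun i : negIdx J f => form J x (f i) • f i) q ∧ S x = p - q

/-- `γ` and `δ` are the bounds `γ₊`, `δ₊` of the canonical dual family `S⁻¹ f i`, i.e. the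
optimal bounds of `(S⁻¹ f i)_{i ∈ I₊}` as a frame for `(M₋^[⊥], [·,·])`. -/
def IsDualBoundsPos (J : FundamentalSymmetry H) (f : ι → H) (S : H →L[ℂ] H) (γ δ : ℝ) : Prop :=
  IsOptimalFrameBounds J 1 (fun i : posIdx J f => Ring.inverse S (f i))
    (orth J (spanNeg J f)) γ δ

/-- `γ` and `δ` are the bounds `γ₋`, `δ₋` of the canonical dual family `S⁻¹ f i`, i.e. the
optimal bounds of `(S⁻¹ f i)_{i ∈ I₋}` as a frame for `(M₊^[⊥], -[·,·])`. -/
def IsDualBoundsNeg (J : FundamentalSymmetry H) (f : ι → H) (S : H →L[ℂ] H) (γ δ : ℝ) : Prop :=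
  IsOptimalFrameBounds J (-1) (fun i : negIdx J f => Ring.inverse S (f i))
    (orth J (spanPos J f)) γ δ

/-- `K` is the angular operator of the J-frame `f` in the representation
`S = [A, -A K; K* A, D]`, taken with respect to the fundamental decomposition
`H = M₋^[⊥] [∔] M₋`. -/
def IsAngularK {J : FundamentalSymmetry H} (f : ι → H) (S : H →L[ℂ] H)
    (𝒟 : FundamentalDecomposition J) (K : 𝒟.minus.Carrier →L[ℂ] 𝒟.plus.Carrier) : Prop :=
  𝒟.plus.space = orth J (spanNeg J f) ∧ 𝒟.minus.space = spanNeg J f ∧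
    ∃ A D, RepresentedWithK 𝒟 S A K D

/-- `L` is the angular operator of the J-frame `f` in the representation
`S = [A, L D; -D L*, D]`, taken with respect to the fundamental decomposition
`H = M₊ [∔] M₊^[⊥]`. -/
def IsAngularL {J : FundamentalSymmetry H} (f : ι → H) (S : H →L[ℂ] H)
    (𝒟 : FundamentalDecomposition J) (L : 𝒟.minus.Carrier →L[ℂ] 𝒟.plus.Carrier) : Prop :=
  𝒟.plus.space = spanPos J f ∧ 𝒟.minus.space = orth J (spanPos J f) ∧
    ∃ A D, RepresentedWithL 𝒟 S A L D

/-- The union of the closed discs with centre `a` and radius `a k`, `a ∈ [lo, hi]`. -/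
def discUnion (k lo hi : ℝ) : Set ℂ :=
  ⋃ a ∈ Set.Icc lo hi, Metric.closedBall (a : ℂ) (a * k)

/-- The union of the closed discs with centre `b / (1 - k²)` and radius `b k / (1 - k²)`,
`b ∈ [lo, hi]`. -/
def discUnion' (k lo hi : ℝ) : Set ℂ :=
  ⋃ b ∈ Set.Icc lo hi, Metric.closedBall ((b / (1 - k ^ 2) : ℝ) : ℂ) (b * k / (1 - k ^ 2))

/-- The sector in the open right half-plane with half opening angle `φ`. -/
def sector (φ : ℝ) : Set ℂ := {z | 0 < z.re ∧ |z.im| ≤ Real.tan φ * z.re}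

end Krein

end

open scoped ComplexConjugate

noncomputable section

namespace Krein

universe u v

section

variable {H : Type u} [NormedAddCommGroup H] [InnerProductSpace ℂ H] [CompleteSpace H]

/-! ### The indefinite inner product -/

/-! Both halves of the theorem are one statement about two subspaces `U`, `V`, definite with
opposite signs `s` and `-s` (`SplitFrame`). Half (i) is `U = M₊`, `V = M₋`, `s = 1`; half (ii)
exchanges them, with `s = -1` and `K = L*`.

Geometry. The frame bounds make `M₊` and `M₋` uniformly definite (`uniformlyDefinite_of_bounds`) and
make their sum closed and dense, so `H = U ∔ V`, and `V^[⊥]` is uniformly definite as well.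

Block form. `S` is symmetric for `[·,·]` and maps `V^[⊥]` into `U`. Hence its first column is `e ↦
(A e, K* A e)`, the subspace `U` is the graph of `K*`, and uniform definiteness of `U` gives `‖K‖ <
1`. The vectors `K y + y` are orthogonal to `U`, and `S` sends them to `Q y` in `V`, with `Q = D +
K* A K`. The quadratic forms of `A` and `Q` are then sums of squares of frame coefficients
(`inner_left`, `inner_right`), which gives uniform positivity. On `A e`, the form of `A` is also the
coefficient sum of the dual family (`inner_left_eq_dual`). So `A⁻¹` lies between `γ` and `δ`, and
`Q` between `α` and `β`.

Spectrum. For an eigenvector `(u, v)` with eigenvalue `l`, put `p = (A⁻¹u, u)` and `b = (Q v, v)`.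
Elimination gives `b = l (‖v‖² - ‖u‖²) + |l|² p` and `|‖u‖² - l p| ≤ ‖K‖ ‖u‖ ‖v‖`. If `l` is not
real, the imaginary part forces `‖u‖ = ‖v‖`. After scaling, `γ ≤ p ≤ δ`, `α ≤ |l|² p ≤ β` and `|1 -
l p| ≤ ‖K‖`, which is membership in both unions of discs. Approximate eigenvectors satisfy these
relations up to the residual, and compactness passes to the limit. A non-real spectral point or its
conjugate is always an approximate eigenvalue, and the conclusion is invariant under conjugation. -/

theorem form_add_right (J : FundamentalSymmetry H) (x y z : H) :
    form J x (y + z) = form J x y + form J x z := by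
  simp [form]

theorem form_smul_right (J : FundamentalSymmetry H) (c : ℂ) (x y : H) :
    form J x (c • y) = conj c * form J x y := by
  simp [form, mul_comm]

theorem form_sub_left (J : FundamentalSymmetry H) (x y z : H) :
    form J (x - y) z = form J x z - form J y z := by
  simp [form]

theorem form_sub_right (J : FundamentalSymmetry H) (x y z : H) :
    form J x (y - z) = form J x y - form J x z := by
  simp [form]

@[simp] theorem form_zero_left (J : FundamentalSymmetry H) (x : H) : form J 0 x = 0 := by
  simp [form]

theorem op_op (J : FundamentalSymmetry H) (x : H) : J.op (J.op x) = x := by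
  have := congrArg (fun T : H →L[ℂ] H => T x) J.mul_self
  simpa using this

theorem inner_op_op (J : FundamentalSymmetry H) (x y : H) :
    inner ℂ (J.op x) (J.op y) = inner ℂ x y := by
  have h := (ContinuousLinearMap.isSelfAdjoint_iff_isSymmetric.mp J.isSelfAdjoint) x (J.op y)
  simp only [ContinuousLinearMap.coe_coe, op_op] at h
  exact h

theorem norm_op_apply (J : FundamentalSymmetry H) (x : H) : ‖J.op x‖ = ‖x‖ := by
  rw [@norm_eq_sqrt_re_inner ℂ, inner_op_op, ← @norm_eq_sqrt_re_inner ℂ]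

theorem norm_form_le (J : FundamentalSymmetry H) (x y : H) : ‖form J x y‖ ≤ ‖x‖ * ‖y‖ := by
  have h := norm_inner_le_norm (𝕜 := ℂ) y (J.op x)
  rw [norm_op_apply] at h
  rw [mul_comm]
  exact h

theorem form_op_left (J : FundamentalSymmetry H) (x y : H) :
    form J (J.op x) y = inner ℂ y x := by
  rw [form, op_op]

theorem form_re_comm (J : FundamentalSymmetry H) (x y : H) :
    (form J x y).re = (form J y x).re := by
  rw [← form_conj, Complex.conj_re]

theorem form_eq_zero_comm {J : FundamentalSymmetry H} {x y : H} (h : form J x y = 0) :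
    form J y x = 0 := by
  rw [← form_conj, h, map_zero]

theorem eq_zero_of_form_eq_zero (J : FundamentalSymmetry H) {x : H}
    (h : ∀ y, form J x y = 0) : x = 0 := by
  have h1 : inner ℂ (J.op x) (J.op x) = 0 := h (J.op x)
  rw [inner_self_eq_zero] at h1
  rw [← op_op J x, h1, map_zero]

/-- The form as a continuous linear functional of its first argument. -/
def formL (J : FundamentalSymmetry H) (y : H) : H →L[ℂ] ℂ := (innerSL ℂ y).comp J.op

@[simp] theorem formL_apply (J : FundamentalSymmetry H) (x y : H) :
    formL J y x = form J x y := rfl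

theorem isClosed_orth (J : FundamentalSymmetry H) (M : Submodule ℂ H) :
    IsClosed (orth J M : Set H) := by
  have : (orth J M : Set H) = ⋂ s ∈ M, {x | formL J s x = 0} := by
    ext x
    simp [orth]
  rw [this]
  exact isClosed_biInter fun s _ => isClosed_eq (formL J s).continuous continuous_const

/-- `s [·,·]` is uniformly positive on `M`. -/
def UniformlyDefinite (J : FundamentalSymmetry H) (s : ℝ) (M : Submodule ℂ H) : Prop :=
  ∃ c : ℝ, 0 < c ∧ ∀ x ∈ M, c * ‖x‖ ^ 2 ≤ s * (form J x x).re

/-! ### Hilbert subspaces of a Krein space -/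

/-- A closed subspace on which `s [·,·]` is uniformly positive is a Hilbert space. -/
def HilbertSubspace.ofClosed {J : FundamentalSymmetry H} {s : ℝ} (M : Submodule ℂ H)
    (hM : IsClosed (M : Set H)) (h : UniformlyDefinite J s M) : HilbertSubspace J s where
  space := M
  pos x hx hx0 := by
    obtain ⟨c, hc, h⟩ := h
    exact lt_of_lt_of_le (by have := norm_pos_iff.mpr hx0; positivity) (h x hx)
  complete w hw hcauchy := by
    obtain ⟨c, hc, h⟩ := h
    -- The intrinsic norm dominates a multiple of the ambient one, so an intrinsic Cauchy sequence
    -- has an ambient limit in `M`. Continuity of the form makes it the intrinsic limit too.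
    have hle : ∀ x ∈ M, √c * ‖x‖ ≤ √(s * (form J x x).re) := fun x hx => by
      rw [← Real.sqrt_sq (norm_nonneg x), ← Real.sqrt_mul hc.le]
      exact Real.sqrt_le_sqrt (h x hx)
    have hc' : 0 < √c := Real.sqrt_pos.mpr hc
    have hcs : CauchySeq w := by
      rw [Metric.cauchySeq_iff]
      intro ε hε
      obtain ⟨N, hN⟩ := hcauchy (√c * ε) (by positivity)
      refine ⟨N, fun m hm n hn => ?_⟩
      have h1 := (hle _ (M.sub_mem (hw m) (hw n))).trans_lt (hN m hm n hn)
      rw [dist_eq_norm]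
      exact lt_of_mul_lt_mul_left h1 hc'.le
    obtain ⟨x, hx⟩ := cauchySeq_tendsto_of_complete hcs
    have hxM : x ∈ M := hM.mem_of_tendsto hx (Filter.Eventually.of_forall hw)
    refine ⟨x, hxM, fun ε hε => ?_⟩
    have hcont : Filter.Tendsto (fun n => √(s * (form J (w n - x) (w n - x)).re))
        Filter.atTop (nhds 0) := by
      have h0 : Filter.Tendsto (fun n => w n - x) Filter.atTop (nhds 0) := by
        simpa using hx.sub_const x
      have hf : Continuous fun z : H => √(s * (form J z z).re) := by
        unfold form
        fun_prop
      simpa [Function.comp_def] using (hf.tendsto 0).comp h0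
    obtain ⟨N, hN⟩ := Filter.eventually_atTop.mp (hcont.eventually (gt_mem_nhds hε))
    exact ⟨N, hN⟩

namespace HilbertSubspace

variable {J : FundamentalSymmetry H} {s : ℝ} (P : HilbertSubspace J s)

theorem exists_incl_eq {x : H} (hx : x ∈ P.space) : ∃ e : P.Carrier, P.incl e = x :=
  ⟨(⟨x, hx⟩ : P.space), rfl⟩

theorem norm_sq_eq (e : P.Carrier) : ‖e‖ ^ 2 = s * (form J (P.incl e) (P.incl e)).re := by
  have h := P.inner_eq e e
  have h2 := congrArg Complex.re h
  rw [Complex.re_ofReal_mul] at h2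
  rw [← h2, ← @inner_self_eq_norm_sq ℂ]
  rfl

theorem norm_incl_le (h : UniformlyDefinite J s P.space) :
    ∃ C : ℝ, ∀ e : P.Carrier, ‖P.incl e‖ ≤ C * ‖e‖ := by
  obtain ⟨c, hc, h⟩ := h
  refine ⟨(√c)⁻¹, fun e => ?_⟩
  have h1 := h _ (P.incl_mem e)
  rw [← P.norm_sq_eq] at h1
  have h2 : √c * ‖P.incl e‖ ≤ ‖e‖ := by
    rw [← Real.sqrt_sq (norm_nonneg (P.incl e)), ← Real.sqrt_mul hc.le,
      ← Real.sqrt_sq (norm_nonneg e)]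
    exact Real.sqrt_le_sqrt h1
  have hc' : 0 < √c := Real.sqrt_pos.mpr hc
  rw [inv_mul_eq_div, le_div_iff₀ hc']
  linarith

/-- The inclusion, as a continuous linear map. -/
def inclL (h : UniformlyDefinite J s P.space) : P.Carrier →L[ℂ] H :=
  P.incl.mkContinuousOfExistsBound (P.norm_incl_le h)

@[simp] theorem inclL_apply (h : UniformlyDefinite J s P.space) (e : P.Carrier) :
    P.inclL h e = P.incl e := rfl

/-- The projection onto a Hilbert subspace along its orthogonal subspace. -/
def proj (h : UniformlyDefinite J s P.space) : H →L[ℂ] P.Carrier :=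
  (s : ℂ) • (ContinuousLinearMap.adjoint (P.inclL h)).comp J.op

theorem inner_proj (h : UniformlyDefinite J s P.space) (e : P.Carrier) (x : H) :
    inner ℂ e (P.proj h x) = (s : ℂ) * form J x (P.incl e) := by
  simp only [proj, smul_apply, ContinuousLinearMap.comp_apply,
    inner_smul_right, ContinuousLinearMap.adjoint_inner_right, inclL_apply]
  rfl

theorem proj_incl (h : UniformlyDefinite J s P.space) (e : P.Carrier) :
    P.proj h (P.incl e) = e := by
  refine ext_inner_left ℂ fun e' => ?_
  rw [inner_proj, inner_eq]

theorem sub_proj_mem_orth (hs : s * s = 1) (h : UniformlyDefinite J s P.space) (x : H) :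
    x - P.incl (P.proj h x) ∈ orth J P.space := by
  intro y hy
  obtain ⟨e, rfl⟩ := P.exists_incl_eq hy
  have h1 := P.inner_proj h e x
  rw [inner_eq] at h1
  have hs0 : (s : ℂ) ≠ 0 := by
    intro h0
    have : s = 0 := by exact_mod_cast h0
    simp [this] at hs
  rw [form_sub_left, mul_left_cancel₀ hs0 h1, sub_self]

theorem proj_eq_zero (h : UniformlyDefinite J s P.space) {x : H} (hx : x ∈ orth J P.space) :
    P.proj h x = 0 := by
  refine ext_inner_left ℂ fun e => ?_
  rw [inner_proj, hx _ (P.incl_mem e), mul_zero, inner_zero_right]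

end HilbertSubspace

theorem inf_orth_eq_bot {J : FundamentalSymmetry H} {s : ℝ} {M : Submodule ℂ H}
    (h : UniformlyDefinite J s M) : M ⊓ orth J M = ⊥ := by
  rw [Submodule.eq_bot_iff]
  rintro x ⟨hx, hx'⟩
  obtain ⟨c, hc, h⟩ := h
  have h1 := h x hx
  rw [hx' x hx, Complex.zero_re, mul_zero] at h1
  by_contra h0
  have := norm_pos_iff.mpr h0
  have : 0 < c * ‖x‖ ^ 2 := by positivity
  linarith

theorem isCompl_orth {J : FundamentalSymmetry H} {s : ℝ} (hs : s * s = 1) {M : Submodule ℂ H}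
    (hM : IsClosed (M : Set H)) (h : UniformlyDefinite J s M) : IsCompl M (orth J M) := by
  refine ⟨disjoint_iff.mpr (inf_orth_eq_bot h), codisjoint_iff.mpr ?_⟩
  rw [eq_top_iff]
  intro x _
  let P := HilbertSubspace.ofClosed M hM h
  rw [Submodule.mem_sup]
  exact ⟨P.incl (P.proj h x), P.incl_mem _, x - P.incl (P.proj h x),
    P.sub_proj_mem_orth hs h x, by abel⟩

end

section

variable {H : Type u} [NormedAddCommGroup H] [InnerProductSpace ℂ H] [CompleteSpace H]

/-! ### Uniform definiteness of the closed spans of a J-frame -/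

/-- With `R = √G` the hypothesis reads `‖R x‖² ≤ C ‖R (R x)‖²`. The range of `R` is dense, since `R`
is self-adjoint and injective, so `‖y‖² ≤ C ‖R y‖² = C (y, G y)` for every `y`. -/
theorem exists_pos_le_inner_of_isPositive {E : Type*} [NormedAddCommGroup E]
    [InnerProductSpace ℂ E] [CompleteSpace E] {G : E →L[ℂ] E} (hG : G.IsPositive)
    (hinj : Function.Injective G) {C : ℝ} (hC : 0 < C)
    (h : ∀ x, (inner ℂ x (G x)).re ≤ C * ‖G x‖ ^ 2) :
    ∃ c : ℝ, 0 < c ∧ ∀ x, c * ‖x‖ ^ 2 ≤ (inner ℂ x (G x)).re := by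
  have hG0 : (0 : E →L[ℂ] E) ≤ G := (ContinuousLinearMap.nonneg_iff_isPositive G).mpr hG
  set R := CFC.sqrt G with hR
  have hRR : R * R = G := CFC.sqrt_mul_sqrt_self G hG0
  have hRsa : IsSelfAdjoint R := IsSelfAdjoint.of_nonneg (CFC.sqrt_nonneg G)
  have hsymm : ∀ x y, inner ℂ (R x) y = inner ℂ x (R y) := fun x y =>
    (ContinuousLinearMap.isSelfAdjoint_iff_isSymmetric.mp hRsa) x y
  have hRR' : ∀ x, R (R x) = G x := fun x => by rw [← hRR]; rfl
  have hin : ∀ x, (inner ℂ x (G x)).re = ‖R x‖ ^ 2 := fun x => by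
    rw [← hRR', ← hsymm, ← @inner_self_eq_norm_sq ℂ]
    rfl
  have hdense : DenseRange R := by
    have : (LinearMap.range (R : E →ₗ[ℂ] E)).topologicalClosure = ⊤ := by
      rw [Submodule.topologicalClosure_eq_top_iff, Submodule.eq_bot_iff]
      intro z hz
      have hz0 : R z = 0 := by
        refine ext_inner_left ℂ fun x => ?_
        rw [← hsymm, inner_zero_right]
        exact (Submodule.mem_orthogonal _ z).mp hz (R x) ⟨x, rfl⟩
      apply hinj
      rw [← hRR', hz0, map_zero, map_zero]
    intro y
    have h1 : y ∈ (LinearMap.range (R : E →ₗ[ℂ] E)).topologicalClosure := by rw [this]; trivial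
    exact h1
  have hle : ∀ y, ‖y‖ ^ 2 ≤ C * ‖R y‖ ^ 2 := by
    intro y
    refine hdense.induction_on (p := fun y => ‖y‖ ^ 2 ≤ C * ‖R y‖ ^ 2) y ?_ ?_
    · exact isClosed_le (by fun_prop) (by fun_prop)
    · intro x
      have := h x
      rwa [hin, ← hRR'] at this
  refine ⟨C⁻¹, inv_pos.mpr hC, fun x => ?_⟩
  rw [hin, inv_mul_le_iff₀ hC]
  exact hle x

/-- Let `G` be the Gram operator of `s [·,·]` on `M`. It is positive by the upper bound and
injective by non-degeneracy. The lower bound and the Bessel bound at `J (G x)` give `(x, G x) ≤ (B /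
α) ‖G x‖²`, so the preceding lemma applies. -/
theorem uniformlyDefinite_of_bounds {J : FundamentalSymmetry H} {s : ℝ} (hs : s * s = 1)
    {M : Submodule ℂ H} (hM : IsClosed (M : Set H)) {κ : Type v} {g : κ → H}
    (hg : ∀ i, g i ∈ M) (hnd : Nondegenerate J M) {α β B : ℝ}
    (hα : IsLowerFrameBound J s g M α) (hβ : IsUpperFrameBound J s g M β) (hB : 0 < B)
    (hbessel : ∀ x, ∑' i, ‖form J x (g i)‖ ^ 2 ≤ B * ‖x‖ ^ 2) :
    UniformlyDefinite J s M := by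
  have : CompleteSpace M := hM.completeSpace_coe
  have hs0 : s ≠ 0 := fun h => by simp [h] at hs
  set G : M →L[ℂ] M := (s : ℂ) • (M.orthogonalProjectionOnto.comp (J.op.comp M.subtypeL)) with hGdef
  have hin : ∀ x y : M, inner ℂ y (G x) = (s : ℂ) * form J x y := fun x y => by
    simp only [hGdef, smul_apply, ContinuousLinearMap.comp_apply,
      inner_smul_right, Submodule.inner_orthogonalProjectionOnto_eq_of_mem_left]
    rfl
  have hre : ∀ x : M, (inner ℂ x (G x)).re = s * (form J (x : H) x).re := fun x => by
    rw [hin, Complex.re_ofReal_mul]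
  have hnonneg : ∀ x : M, 0 ≤ (inner ℂ x (G x)).re := fun x => by
    rw [hre]
    have h1 := (hβ.2 x x.2).2
    have h2 : 0 ≤ ∑' i, ‖form J (x : H) (g i)‖ ^ 2 := tsum_nonneg fun i => by positivity
    exact nonneg_of_mul_nonneg_right (h2.trans h1) hβ.1
  have hsa : IsSelfAdjoint G := by
    rw [ContinuousLinearMap.isSelfAdjoint_iff_isSymmetric]
    intro x y
    simp only [ContinuousLinearMap.coe_coe]
    rw [hin, ← inner_conj_symm, hin, map_mul, form_conj, Complex.conj_ofReal]
  have hpos : G.IsPositive := by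
    rw [ContinuousLinearMap.isPositive_def']
    refine ⟨hsa, fun x => ?_⟩
    have h1 := hnonneg x
    rw [ContinuousLinearMap.reApplyInnerSelf_apply, inner_re_symm]
    exact h1
  have hinj : Function.Injective G := by
    rw [injective_iff_map_eq_zero]
    intro x hx
    have h1 : (x : H) ∈ M ⊓ orth J M := by
      refine ⟨x.2, fun y hy => ?_⟩
      have h2 := hin x ⟨y, hy⟩
      rw [hx, inner_zero_right] at h2
      rcases mul_eq_zero.mp h2.symm with h3 | h3
      · exact absurd (by exact_mod_cast h3) hs0
      · exact h3
    rw [hnd] at h1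
    exact Subtype.ext h1
  have hGx : ∀ x : M, ∀ i, form J (x : H) (g i) = (s : ℂ) * form J (J.op (G x : H)) (g i) := by
    intro x i
    have h1 := hin x ⟨g i, hg i⟩
    rw [form_op_left]
    have h2 : inner ℂ (g i) (G x : H) = (s : ℂ) * form J (x : H) (g i) := h1
    rw [h2, ← mul_assoc, ← Complex.ofReal_mul, hs, Complex.ofReal_one, one_mul]
  have hbd : ∀ x : M, (inner ℂ x (G x)).re ≤ B / α * ‖G x‖ ^ 2 := fun x => by
    have h1 := (hα.2 x x.2).2
    rw [hre, div_mul_eq_mul_div, le_div_iff₀ hα.1, mul_comm _ α]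
    refine h1.trans ?_
    have h2 := hbessel (J.op (G x : H))
    rw [norm_op_apply] at h2
    refine le_trans (le_of_eq ?_) h2
    congr 1
    ext i
    have hsn : ‖(s : ℂ)‖ = 1 := by
      rw [Complex.norm_real, Real.norm_eq_abs]
      rcases mul_self_eq_one_iff.mp hs with h | h <;> simp [h]
    rw [hGx, norm_mul, hsn, one_mul]
  obtain ⟨c, hc, h⟩ := exists_pos_le_inner_of_isPositive hpos hinj (div_pos hB hα.1) hbd
  refine ⟨c, hc, fun x hx => ?_⟩
  have := h ⟨x, hx⟩
  rwa [hre] at this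

/-- In `Re [x + y, x - y]` the cross terms cancel, leaving `[x, x] - [y, y]`. -/
theorem norm_sq_add_norm_sq_le {J : FundamentalSymmetry H} {s : ℝ} (hs : s * s = 1)
    {U V : Submodule ℂ H} (hU : UniformlyDefinite J s U) (hV : UniformlyDefinite J (-s) V) :
    ∃ c : ℝ, 0 < c ∧ ∀ x ∈ U, ∀ y ∈ V, c * (‖x‖ ^ 2 + ‖y‖ ^ 2) ≤ ‖x + y‖ * ‖x - y‖ := by
  obtain ⟨c, hc, hU⟩ := hU
  obtain ⟨d, hd, hV⟩ := hV
  refine ⟨min c d, lt_min hc hd, fun x hx y hy => ?_⟩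
  have h1 := hU x hx
  have h2 := hV y hy
  have h3 : s * (form J (x + y) (x - y)).re = s * (form J x x).re + -s * (form J y y).re := by
    simp only [form_add_left, form_sub_right, Complex.add_re, Complex.sub_re]
    rw [form_re_comm J x y]
    ring
  have h4 : s * (form J (x + y) (x - y)).re ≤ ‖x + y‖ * ‖x - y‖ := by
    refine le_trans (le_abs_self _) ?_
    have hsn : |s| = 1 := by rcases mul_self_eq_one_iff.mp hs with h | h <;> simp [h]
    rw [abs_mul, hsn, one_mul]
    exact (Complex.abs_re_le_norm _).trans (norm_form_le J _ _)
  have h5 : min c d * ‖x‖ ^ 2 ≤ c * ‖x‖ ^ 2 := by gcongr; exact min_le_left _ _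
  have h6 : min c d * ‖y‖ ^ 2 ≤ d * ‖y‖ ^ 2 := by gcongr; exact min_le_right _ _
  linarith

/-- The addition map `U × V → H` is bounded below: for `m = max ‖x‖ ‖y‖` the previous estimate gives
`c m² ≤ ‖x + y‖ · 2m`. -/
theorem isClosed_sup {J : FundamentalSymmetry H} {s : ℝ} (hs : s * s = 1)
    {U V : Submodule ℂ H} (hUc : IsClosed (U : Set H)) (hVc : IsClosed (V : Set H))
    (hU : UniformlyDefinite J s U) (hV : UniformlyDefinite J (-s) V) :
    IsClosed ((U ⊔ V : Submodule ℂ H) : Set H) := by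
  have : CompleteSpace U := hUc.completeSpace_coe
  have : CompleteSpace V := hVc.completeSpace_coe
  obtain ⟨c, hc, h⟩ := norm_sq_add_norm_sq_le hs hU hV
  set Φ : (U × V) →L[ℂ] H := U.subtypeL.coprod V.subtypeL with hΦ
  have hΦa : ∀ z : U × V, Φ z = (z.1 : H) + (z.2 : H) := fun z => by simp [hΦ]
  have hbd : ∀ z : U × V, ‖z‖ ≤ 2 / c * ‖Φ z‖ := by
    rintro ⟨x, y⟩
    have h1 := h x x.2 y y.2
    rw [hΦa, div_mul_eq_mul_div, le_div_iff₀ hc, Prod.norm_def]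
    simp only [Submodule.coe_norm]
    set m := max ‖(x : H)‖ ‖(y : H)‖ with hm
    have hx : ‖(x : H)‖ ≤ m := le_max_left _ _
    have hy : ‖(y : H)‖ ≤ m := le_max_right _ _
    have hsub : ‖(x : H) - y‖ ≤ 2 * m := (norm_sub_le _ _).trans (by linarith)
    have hm2 : m ^ 2 ≤ ‖(x : H)‖ ^ 2 + ‖(y : H)‖ ^ 2 := by
      rcases max_choice ‖(x : H)‖ ‖(y : H)‖ with h' | h' <;> rw [hm, h'] <;>
        nlinarith [sq_nonneg ‖(x : H)‖, sq_nonneg ‖(y : H)‖]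
    have h2 : c * m ^ 2 ≤ ‖(x : H) + y‖ * (2 * m) :=
      (mul_le_mul_of_nonneg_left hm2 hc.le).trans
        (h1.trans (mul_le_mul_of_nonneg_left hsub (norm_nonneg _)))
    rcases (le_trans (norm_nonneg _) hx : 0 ≤ m).eq_or_lt with h0 | h0
    · rw [← h0, zero_mul]; positivity
    · refine le_of_mul_le_mul_right ?_ h0
      nlinarith
  have hanti : AntilipschitzWith (Real.toNNReal (2 / c)) Φ :=
    ContinuousLinearMap.antilipschitz_of_bound Φ fun z => by
      rw [Real.coe_toNNReal _ (by positivity)]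
      exact hbd z
  have hcl := hanti.isClosed_range Φ.uniformContinuous
  convert hcl using 1
  ext z
  simp only [SetLike.mem_coe, Submodule.mem_sup, Set.mem_range, Prod.exists, hΦa]
  constructor
  · rintro ⟨x, hx, y, hy, rfl⟩
    exact ⟨⟨x, hx⟩, ⟨y, hy⟩, rfl⟩
  · rintro ⟨x, y, rfl⟩
    exact ⟨x, x.2, y, y.2, rfl⟩

/-- If `p + m` is orthogonal to `m`, then `[p + m, p + m] = [p, p] - [m, m]`, and both terms
contribute with the sign `s`. -/
theorem uniformlyDefinite_orth {J : FundamentalSymmetry H} {s : ℝ}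
    {U V : Submodule ℂ H} (hU : UniformlyDefinite J s U) (hV : UniformlyDefinite J (-s) V)
    (htop : U ⊔ V = ⊤) : UniformlyDefinite J s (orth J V) := by
  obtain ⟨c, hc, hU⟩ := hU
  obtain ⟨d, hd, hV⟩ := hV
  refine ⟨min c d / 2, half_pos (lt_min hc hd), fun x hx => ?_⟩
  have hxt : x ∈ U ⊔ V := by rw [htop]; trivial
  obtain ⟨p, hp, m, hm, rfl⟩ := Submodule.mem_sup.mp hxt
  have h1 := hU p hp
  have h2 := hV m hm
  have h0 := hx m hm
  have h0' := form_eq_zero_comm h0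
  have h3 : form J (p + m) (p + m) = form J p p - form J m m := by
    rw [form_add_left] at h0
    rw [form_add_right] at h0'
    simp only [form_add_left, form_add_right]
    linear_combination h0 + h0'
  rw [h3, Complex.sub_re]
  have h5 : min c d * ‖p‖ ^ 2 ≤ c * ‖p‖ ^ 2 := by gcongr; exact min_le_left _ _
  have h6 : min c d * ‖m‖ ^ 2 ≤ d * ‖m‖ ^ 2 := by gcongr; exact min_le_right _ _
  have h7 : ‖p + m‖ ^ 2 ≤ 2 * (‖p‖ ^ 2 + ‖m‖ ^ 2) := by
    have h8 : ‖p + m‖ ^ 2 ≤ (‖p‖ + ‖m‖) ^ 2 := by gcongr; exact norm_add_le _ _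
    nlinarith [sq_nonneg (‖p‖ - ‖m‖)]
  have h9 : min c d / 2 * ‖p + m‖ ^ 2 ≤ min c d / 2 * (2 * (‖p‖ ^ 2 + ‖m‖ ^ 2)) := by
    have := (half_pos (lt_min hc hd)).le
    gcongr
  linarith

end

section

variable {H : Type u} [NormedAddCommGroup H] [InnerProductSpace ℂ H] [CompleteSpace H]

/-! ### Block representation of the frame operator -/

/-- Two families in subspaces `U` and `V`, uniformly definite for `s [·,·]` and `-s [·,·]`, and
their frame operator. Both halves of a J-frame, in either order, are of this kind. -/
structure SplitFrame (J : FundamentalSymmetry H) (s : ℝ) (U V : Submodule ℂ H)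
    {κ μ : Type v} (g : κ → H) (h : μ → H) (S : H →L[ℂ] H) : Prop where
  sign : s * s = 1
  closed_left : IsClosed (U : Set H)
  closed_right : IsClosed (V : Set H)
  left_mem : ∀ i, g i ∈ U
  right_mem : ∀ i, h i ∈ V
  definite_left : UniformlyDefinite J s U
  definite_right : UniformlyDefinite J (-s) V
  sup_eq_top : U ⊔ V = ⊤
  lower_left : ∃ α : ℝ, 0 < α ∧ ∀ x ∈ orth J V, α * ‖x‖ ^ 2 ≤ ∑' i, ‖form J x (g i)‖ ^ 2
  lower_right : ∃ α : ℝ, 0 < α ∧ ∀ x ∈ V, α * (-s * (form J x x).re) ≤ ∑' i, ‖form J x (h i)‖ ^ 2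
  sum : ∀ x, ∃ p q : H, HasSum (fun i => form J x (g i) • g i) p ∧
    HasSum (fun i => form J x (h i) • h i) q ∧ S x = (s : ℂ) • (p - q)

namespace SplitFrame

variable {J : FundamentalSymmetry H} {s : ℝ} {U V : Submodule ℂ H}
  {κ μ : Type v} {g : κ → H} {h : μ → H} {S : H →L[ℂ] H}

theorem exists_form_apply (hF : SplitFrame J s U V g h S) (x y : H) : ∃ a b : ℂ,
    HasSum (fun i => form J x (g i) * form J (g i) y) a ∧
    HasSum (fun i => form J x (h i) * form J (h i) y) b ∧ form J (S x) y = s * (a - b) := by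
  obtain ⟨p, q, hp, hq, hS⟩ := hF.sum x
  refine ⟨form J p y, form J q y, ?_, ?_, ?_⟩
  · simpa [form_smul_left] using hp.mapL (formL J y)
  · simpa [form_smul_left] using hq.mapL (formL J y)
  · rw [hS, form_smul_left, form_sub_left]

/-- Termwise conjugation of the two series exchanges `x` and `y`. -/
theorem form_apply_comm (hF : SplitFrame J s U V g h S) (x y : H) :
    form J (S x) y = form J x (S y) := by
  obtain ⟨a, b, ha, hb, h1⟩ := hF.exists_form_apply x y
  obtain ⟨a', b', ha', hb', h2⟩ := hF.exists_form_apply y x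
  have key : ∀ {ν : Type v} (k : ν → H) {c c' : ℂ},
      HasSum (fun i => form J x (k i) * form J (k i) y) c →
      HasSum (fun i => form J y (k i) * form J (k i) x) c' → conj c' = c := by
    intro ν k c c' hc hc'
    refine HasSum.unique ?_ hc
    have h3 := hc'.map (starRingEnd ℂ) Complex.continuous_conj
    convert h3 using 2 with i
    simp only [Function.comp, map_mul, form_conj]
    ring
  rw [h1, ← form_conj, h2, map_mul, map_sub, key g ha ha', key h hb hb', Complex.conj_ofReal]

/-- Source of all positivity of the blocks: vectors orthogonal to `V` or to `U` annihilate one of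
the two sums. -/
theorem sign_mul_form_apply_self (hF : SplitFrame J s U V g h S) (x : H) :
    s * (form J (S x) x).re =
      ∑' i, ‖form J x (g i)‖ ^ 2 - ∑' i, ‖form J x (h i)‖ ^ 2 := by
  obtain ⟨a, b, ha, hb, h1⟩ := hF.exists_form_apply x x
  have key : ∀ {ν : Type v} (k : ν → H) {c : ℂ},
      HasSum (fun i => form J x (k i) * form J (k i) x) c →
      ∑' i, ‖form J x (k i)‖ ^ 2 = c.re := by
    intro ν k c hc
    refine HasSum.tsum_eq ?_
    have h3 := Complex.hasSum_re hc
    convert h3 using 2 with i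
    rw [← form_conj J x (k i), Complex.mul_conj, Complex.ofReal_re, Complex.normSq_eq_norm_sq]
  rw [h1, Complex.re_ofReal_mul, ← mul_assoc, hF.sign, one_mul, key g ha, key h hb,
    Complex.sub_re]

theorem apply_mem_left (hF : SplitFrame J s U V g h S) {x : H} (hx : x ∈ orth J V) :
    S x ∈ U := by
  obtain ⟨p, q, hp, hq, hS⟩ := hF.sum x
  have hq0 : q = 0 := by
    refine hq.unique ?_
    simp only [fun i => hx _ (hF.right_mem i), zero_smul]
    exact hasSum_zero
  have hpU : p ∈ U :=
    hF.closed_left.mem_of_tendsto hp (Filter.Eventually.of_forall fun F =>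
      U.sum_mem fun i _ => U.smul_mem _ (hF.left_mem i))
  rw [hS, hq0, sub_zero]
  exact U.smul_mem _ hpU

theorem inf_eq_bot (hF : SplitFrame J s U V g h S) : U ⊓ V = ⊥ := by
  rw [Submodule.eq_bot_iff]
  rintro x ⟨hx, hx'⟩
  obtain ⟨c, hc, h1⟩ := hF.definite_left
  obtain ⟨d, hd, h2⟩ := hF.definite_right
  have h3 := h1 x hx
  have h4 := h2 x hx'
  by_contra h0
  have := norm_pos_iff.mpr h0
  have h5 : 0 < c * ‖x‖ ^ 2 := by positivity
  have h6 : 0 < d * ‖x‖ ^ 2 := by positivity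
  linarith

theorem definite_orth (hF : SplitFrame J s U V g h S) : UniformlyDefinite J s (orth J V) :=
  uniformlyDefinite_orth hF.definite_left hF.definite_right hF.sup_eq_top

end SplitFrame

theorem UniformlyPositive.isUnit {E : Type u} [NormedAddCommGroup E] [InnerProductSpace ℂ E]
    [CompleteSpace E] {T : E →L[ℂ] E} (h : UniformlyPositive T) : IsUnit T := by
  obtain ⟨-, c, hc, h⟩ := h
  refine ContinuousLinearMap.isUnit_of_forall_le_norm_inner_map T (c := ⟨c, hc.le⟩) hc fun x => ?_
  have h1 := h x
  rw [← inner_conj_symm, RCLike.norm_conj, mul_comm]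
  exact h1.trans ((le_abs_self _).trans (Complex.abs_re_le_norm _))

theorem UniformlyPositive.surjective {E : Type u} [NormedAddCommGroup E] [InnerProductSpace ℂ E]
    [CompleteSpace E] {T : E →L[ℂ] E} (h : UniformlyPositive T) : Function.Surjective T := by
  intro y
  obtain ⟨R, hR⟩ := h.isUnit.exists_right_inv
  refine ⟨R y, ?_⟩
  have := congrArg (fun L : E →L[ℂ] E => L y) hR
  simpa using this

theorem HilbertSubspace.form_incl {J : FundamentalSymmetry H} {s : ℝ} (P : HilbertSubspace J s)
    (hs : s * s = 1) (x y : P.Carrier) :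
    form J (P.incl x) (P.incl y) = s * inner ℂ y x := by
  rw [P.inner_eq, ← mul_assoc, ← Complex.ofReal_mul, hs, Complex.ofReal_one, one_mul]

/-- The operator `S` has the block form `[A, -A K; K* A, D]` with respect to `P` and `N`, with
the positivity properties of `RepresentedWithK`. -/
structure BlockRep {J : FundamentalSymmetry H} {s t : ℝ} (P : HilbertSubspace J s)
    (N : HilbertSubspace J t) (S : H →L[ℂ] H) (A : P.Carrier →L[ℂ] P.Carrier)
    (K : N.Carrier →L[ℂ] P.Carrier) (D : N.Carrier →L[ℂ] N.Carrier) : Prop where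
  matrix : ∀ x y, S (P.incl x + N.incl y) =
    P.incl (A x - A (K y)) + N.incl (ContinuousLinearMap.adjoint K (A x) + D y)
  uniformlyPositive : UniformlyPositive A
  norm_lt_one : ‖K‖ < 1
  isSelfAdjoint : IsSelfAdjoint D
  uniformlyPositive_schur :
    UniformlyPositive (D + (ContinuousLinearMap.adjoint K).comp (A.comp K))

namespace SplitFrame

variable {J : FundamentalSymmetry H} {s t : ℝ} {U V : Submodule ℂ H}
  {κ μ : Type v} {g : κ → H} {h : μ → H} {S : H →L[ℂ] H}
  {P : HilbertSubspace J s} {N : HilbertSubspace J t}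

theorem isCompl (hF : SplitFrame J s U V g h S) : IsCompl (orth J V) V :=
  (isCompl_orth (by rw [neg_mul_neg, hF.sign]) hF.closed_right hF.definite_right).symm

theorem form_left_right (hP : P.space = orth J V) (hN : N.space = V)
    (x : P.Carrier) (y : N.Carrier) : form J (P.incl x) (N.incl y) = 0 :=
  (hP ▸ P.incl_mem x : P.incl x ∈ orth J V) _ (hN ▸ N.incl_mem y)

theorem form_right_left (hP : P.space = orth J V) (hN : N.space = V)
    (x : P.Carrier) (y : N.Carrier) : form J (N.incl y) (P.incl x) = 0 :=
  form_eq_zero_comm (form_left_right hP hN x y)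

theorem exists_eq_add (hF : SplitFrame J s U V g h S) (hP : P.space = orth J V)
    (hN : N.space = V) (z : H) : ∃ (x : P.Carrier) (y : N.Carrier), z = P.incl x + N.incl y := by
  have hz : z ∈ orth J V ⊔ V := by rw [hF.isCompl.sup_eq_top]; trivial
  obtain ⟨p, hp, n, hn, rfl⟩ := Submodule.mem_sup.mp hz
  obtain ⟨x, rfl⟩ := P.exists_incl_eq (hP ▸ hp)
  obtain ⟨y, rfl⟩ := N.exists_incl_eq (hN ▸ hn)
  exact ⟨x, y, rfl⟩

theorem proj_left (hP : P.space = orth J V) (hN : N.space = V)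
    (hPd : UniformlyDefinite J s P.space) (x : P.Carrier) (y : N.Carrier) :
    P.proj hPd (P.incl x + N.incl y) = x := by
  rw [map_add, P.proj_incl, P.proj_eq_zero hPd, add_zero]
  intro z hz
  obtain ⟨x', rfl⟩ := P.exists_incl_eq hz
  exact form_right_left hP hN x' y

theorem proj_right (hP : P.space = orth J V) (hN : N.space = V)
    (hNd : UniformlyDefinite J t N.space) (x : P.Carrier) (y : N.Carrier) :
    N.proj hNd (P.incl x + N.incl y) = y := by
  rw [map_add, N.proj_incl, N.proj_eq_zero hNd, zero_add]
  intro z hz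
  obtain ⟨y', rfl⟩ := N.exists_incl_eq hz
  exact form_left_right hP hN x y'

variable {A : P.Carrier →L[ℂ] P.Carrier} {K : N.Carrier →L[ℂ] P.Carrier}
  {D : N.Carrier →L[ℂ] N.Carrier}

/-- Writing `x = A e`, the vector is `S e` with `e ∈ V^[⊥]`. Together with `exists_eq_graph`, this
identifies `U` with the graph of `K*`. -/
theorem graph_mem (hF : SplitFrame J s U V g h S) (hP : P.space = orth J V)
    (hmat : ∀ x y, S (P.incl x + N.incl y) =
      P.incl (A x - A (K y)) + N.incl (ContinuousLinearMap.adjoint K (A x) + D y))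
    (hA : UniformlyPositive A) (x : P.Carrier) :
    P.incl x + N.incl (ContinuousLinearMap.adjoint K x) ∈ U := by
  obtain ⟨e, rfl⟩ := hA.surjective x
  have h1 := hmat e 0
  simp only [map_zero, add_zero, sub_zero] at h1
  rw [← h1]
  exact hF.apply_mem_left (hP ▸ P.incl_mem e)

theorem exists_eq_graph (hF : SplitFrame J s U V g h S) (hP : P.space = orth J V)
    (hN : N.space = V)
    (hmat : ∀ x y, S (P.incl x + N.incl y) =
      P.incl (A x - A (K y)) + N.incl (ContinuousLinearMap.adjoint K (A x) + D y))
    (hA : UniformlyPositive A) {z : H} (hz : z ∈ U) :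
    ∃ x, z = P.incl x + N.incl (ContinuousLinearMap.adjoint K x) := by
  obtain ⟨x, y, rfl⟩ := hF.exists_eq_add hP hN z
  refine ⟨x, ?_⟩
  have h1 := U.sub_mem hz (hF.graph_mem hP hmat hA x)
  have h2 : P.incl x + N.incl y - (P.incl x + N.incl (ContinuousLinearMap.adjoint K x)) =
      N.incl (y - ContinuousLinearMap.adjoint K x) := by
    rw [map_sub]; abel
  have h3 : P.incl x + N.incl y - (P.incl x + N.incl (ContinuousLinearMap.adjoint K x)) ∈ U ⊓ V :=
    ⟨h1, by rw [h2, ← hN]; exact N.incl_mem _⟩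
  rw [hF.inf_eq_bot] at h3
  exact sub_eq_zero.mp h3

/-- Because the two Hilbert space inner products carry opposite signs, the graph of `K` is
orthogonal to the graph of `K*`. -/
theorem angular_mem_orth (hF : SplitFrame J s U V g h S) (ht : t = -s) (hP : P.space = orth J V)
    (hN : N.space = V)
    (hmat : ∀ x y, S (P.incl x + N.incl y) =
      P.incl (A x - A (K y)) + N.incl (ContinuousLinearMap.adjoint K (A x) + D y))
    (hA : UniformlyPositive A) (y : N.Carrier) : P.incl (K y) + N.incl y ∈ orth J U := by
  intro z hz
  obtain ⟨x, rfl⟩ := hF.exists_eq_graph hP hN hmat hA hz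
  have ht' : t * t = 1 := by rw [ht, neg_mul_neg, hF.sign]
  simp only [form_add_left, form_add_right, form_left_right hP hN, form_right_left hP hN,
    P.form_incl hF.sign, N.form_incl ht', ContinuousLinearMap.adjoint_inner_left, ht]
  push_cast
  ring

theorem apply_angular (hmat : ∀ x y, S (P.incl x + N.incl y) =
      P.incl (A x - A (K y)) + N.incl (ContinuousLinearMap.adjoint K (A x) + D y))
    (y : N.Carrier) : S (P.incl (K y) + N.incl y) =
      N.incl ((D + (ContinuousLinearMap.adjoint K).comp (A.comp K)) y) := by
  rw [hmat, sub_self, map_zero, zero_add, add_comm]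
  rfl

theorem inner_left (hF : SplitFrame J s U V g h S) (hP : P.space = orth J V)
    (hN : N.space = V)
    (hmat : ∀ x y, S (P.incl x + N.incl y) =
      P.incl (A x - A (K y)) + N.incl (ContinuousLinearMap.adjoint K (A x) + D y))
    (x : P.Carrier) : (inner ℂ x (A x)).re = ∑' i, ‖form J (P.incl x) (g i)‖ ^ 2 := by
  have h1 := hF.sign_mul_form_apply_self (P.incl x)
  have h2 := hmat x 0
  simp only [map_zero, add_zero, sub_zero] at h2
  have hx : P.incl x ∈ orth J V := hP ▸ P.incl_mem x
  rw [h2, form_add_left, form_right_left hP hN, add_zero, P.form_incl hF.sign,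
    Complex.re_ofReal_mul, ← mul_assoc, hF.sign, one_mul] at h1
  rw [h1]
  simp [fun i => hx _ (hF.right_mem i)]

/-- Evaluate `[S z, z]` at `z = K y + y`: the coefficients against `g` vanish, and those against `h`
see only `y`. -/
theorem inner_right (hF : SplitFrame J s U V g h S) (ht : t = -s) (hP : P.space = orth J V)
    (hN : N.space = V)
    (hmat : ∀ x y, S (P.incl x + N.incl y) =
      P.incl (A x - A (K y)) + N.incl (ContinuousLinearMap.adjoint K (A x) + D y))
    (hA : UniformlyPositive A) (y : N.Carrier) :
    (inner ℂ y ((D + (ContinuousLinearMap.adjoint K).comp (A.comp K)) y)).re =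
      ∑' i, ‖form J (N.incl y) (h i)‖ ^ 2 := by
  have h1 := hF.sign_mul_form_apply_self (P.incl (K y) + N.incl y)
  have ht' : t * t = 1 := by rw [ht, neg_mul_neg, hF.sign]
  have hst : s * t = -1 := by rw [ht, mul_neg, hF.sign]
  have hx := hF.angular_mem_orth ht hP hN hmat hA y
  have hPV : ∀ i, form J (P.incl (K y)) (h i) = 0 := fun i =>
    (hP ▸ P.incl_mem (K y) : P.incl (K y) ∈ orth J V) _ (hF.right_mem i)
  rw [apply_angular hmat, form_add_right, form_right_left hP hN, zero_add, N.form_incl ht',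
    Complex.re_ofReal_mul, ← mul_assoc, hst] at h1
  simp only [fun i => hx _ (hF.left_mem i), form_add_left J _ _ (h _), hPV, norm_zero, ne_eq,
    OfNat.ofNat_ne_zero, not_false_eq_true, zero_pow, tsum_zero, zero_add] at h1
  linarith

theorem exists_blockRep (hF : SplitFrame J s U V g h S) (ht : t = -s) (hP : P.space = orth J V)
    (hN : N.space = V) : ∃ A K D, BlockRep P N S A K D := by
  have ht' : t * t = 1 := by rw [ht, neg_mul_neg, hF.sign]
  have hPd : UniformlyDefinite J s P.space := hP ▸ hF.definite_orth
  have hVd : UniformlyDefinite J t V := ht ▸ hF.definite_right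
  have hNd : UniformlyDefinite J t N.space := hN ▸ hVd
  have hst : (s : ℂ) = -(t : ℂ) := by rw [ht, Complex.ofReal_neg, neg_neg]
  have hdec : ∀ z, z = P.incl (P.proj hPd z) + N.incl (N.proj hNd z) := fun z => by
    obtain ⟨x, y, rfl⟩ := hF.exists_eq_add hP hN z
    rw [proj_left hP hN, proj_right hP hN]
  set A := (P.proj hPd).comp (S.comp (P.inclL hPd)) with hAdef
  set B := (N.proj hNd).comp (S.comp (P.inclL hPd)) with hBdef
  set D := (N.proj hNd).comp (S.comp (N.inclL hNd)) with hDdef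
  have hAa : ∀ x, A x = P.proj hPd (S (P.incl x)) := fun _ => rfl
  have hBa : ∀ x, B x = N.proj hNd (S (P.incl x)) := fun _ => rfl
  have hDa : ∀ x, D x = N.proj hNd (S (N.incl x)) := fun _ => rfl
  have hAsa : IsSelfAdjoint A := by
    rw [ContinuousLinearMap.isSelfAdjoint_iff_isSymmetric]
    intro x y
    simp only [ContinuousLinearMap.coe_coe]
    rw [← inner_conj_symm, hAa, hAa, P.inner_proj, P.inner_proj, map_mul, form_conj,
      Complex.conj_ofReal, hF.form_apply_comm]
  have hDsa : IsSelfAdjoint D := by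
    rw [ContinuousLinearMap.isSelfAdjoint_iff_isSymmetric]
    intro x y
    simp only [ContinuousLinearMap.coe_coe]
    rw [← inner_conj_symm, hDa, hDa, N.inner_proj, N.inner_proj, map_mul, form_conj,
      Complex.conj_ofReal, hF.form_apply_comm]
  have hA : UniformlyPositive A := by
    refine ⟨hAsa, ?_⟩
    obtain ⟨α, hα, h1⟩ := hF.lower_left
    refine ⟨α, hα, fun x => ?_⟩
    have hx : P.incl x ∈ orth J V := hP ▸ P.incl_mem x
    have h2 := hF.sign_mul_form_apply_self (P.incl x)
    have h3 : ∑' i, ‖form J (P.incl x) (h i)‖ ^ 2 = 0 := by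
      simp [fun i => hx _ (hF.right_mem i)]
    rw [h3, sub_zero] at h2
    have h4 : ‖x‖ ^ 2 ≤ ‖P.incl x‖ ^ 2 := by
      rw [P.norm_sq_eq]
      refine (le_abs_self _).trans ?_
      have hsn : |s| = 1 := by rcases mul_self_eq_one_iff.mp hF.sign with h | h <;> simp [h]
      rw [abs_mul, hsn, one_mul, sq]
      exact (Complex.abs_re_le_norm _).trans (norm_form_le J _ _)
    rw [hAa, P.inner_proj, Complex.re_ofReal_mul, h2]
    exact (mul_le_mul_of_nonneg_left h4 hα.le).trans (h1 _ hx)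
  obtain ⟨R, hR⟩ := hA.isUnit.exists_left_inv
  have hRA : ∀ x, R (A x) = x := fun x => by
    have := congrArg (fun L : P.Carrier →L[ℂ] P.Carrier => L x) hR
    simpa using this
  -- Forced by the lower left block: `K* A = B` means `K* = B A⁻¹`. Symmetry of `S` then gives the
  -- upper right block `-A K`.
  set K := ContinuousLinearMap.adjoint (B.comp R) with hKdef
  have hKA : ∀ x, ContinuousLinearMap.adjoint K (A x) = B x := fun x => by
    rw [hKdef, ContinuousLinearMap.adjoint_adjoint, ContinuousLinearMap.comp_apply, hRA]
  have hAK : ∀ y, P.proj hPd (S (N.incl y)) = -A (K y) := fun y => by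
    refine ext_inner_left ℂ fun e => ?_
    have hsymm := (ContinuousLinearMap.isSelfAdjoint_iff_isSymmetric.mp hAsa) e (K y)
    simp only [ContinuousLinearMap.coe_coe] at hsymm
    rw [P.inner_proj, inner_neg_right, ← hsymm, ← ContinuousLinearMap.adjoint_inner_left, hKA,
      ← inner_conj_symm, hBa, N.inner_proj, map_mul, form_conj, Complex.conj_ofReal,
      hF.form_apply_comm, hst, neg_mul]
  have hmat : ∀ x y, S (P.incl x + N.incl y) =
      P.incl (A x - A (K y)) + N.incl (ContinuousLinearMap.adjoint K (A x) + D y) := by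
    intro x y
    rw [hdec (S (P.incl x + N.incl y)), map_add S, map_add, map_add (N.proj hNd), hAK, hKA, hAa x,
      hBa x, hDa y, sub_eq_add_neg]
  have hKn : ‖K‖ < 1 := by
    obtain ⟨c, hc, h1⟩ := hF.definite_left
    set M := ‖P.proj hPd‖ with hM
    have hM0 : 0 ≤ M := by exact norm_nonneg (P.proj hPd)
    -- For `z = x + K* x` in `U`, `‖x‖² - ‖K* x‖² = s [z, z] ≥ c ‖z‖²` and `‖x‖ ≤ (M + 1) ‖z‖`. The
    -- `+ 1` avoids dividing by zero when the projection vanishes, and the maximum with `0` allows a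
    -- square root.
    set ρ := max (1 - c / (M + 1) ^ 2) 0 with hρ
    have hρ1 : ρ < 1 := max_lt (by have : 0 < c / (M + 1) ^ 2 := by positivity
                                   linarith) one_pos
    have hbd : ∀ x, ‖ContinuousLinearMap.adjoint K x‖ ^ 2 ≤ ρ * ‖x‖ ^ 2 := fun x => by
      have h2 := h1 _ (hF.graph_mem hP hmat hA x)
      set z := P.incl x + N.incl (ContinuousLinearMap.adjoint K x) with hz
      have h3 : s * (form J z z).re = ‖x‖ ^ 2 - ‖ContinuousLinearMap.adjoint K x‖ ^ 2 := by
        rw [P.norm_sq_eq, N.norm_sq_eq, hz]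
        simp only [form_add_left, form_add_right, form_left_right hP hN, form_right_left hP hN,
          Complex.add_re, Complex.zero_re, ht]
        ring
      have h4 : ‖x‖ ≤ (M + 1) * ‖z‖ := by
        have h5 : P.proj hPd z = x := by rw [hz, proj_left hP hN]
        have h6 := (P.proj hPd).le_opNorm z
        rw [h5] at h6
        nlinarith [norm_nonneg z]
      have h5 : ‖x‖ ^ 2 ≤ (M + 1) ^ 2 * ‖z‖ ^ 2 := by
        rw [← mul_pow]; gcongr
      have h6 : c / (M + 1) ^ 2 * ‖x‖ ^ 2 ≤ c * ‖z‖ ^ 2 := by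
        rw [div_mul_eq_mul_div, div_le_iff₀ (by positivity)]
        nlinarith
      have h7 : (1 - c / (M + 1) ^ 2) * ‖x‖ ^ 2 ≤ ρ * ‖x‖ ^ 2 := by
        gcongr; exact le_max_left _ _
      linarith
    have h8 : ‖ContinuousLinearMap.adjoint K‖ ≤ √ρ := by
      refine ContinuousLinearMap.opNorm_le_bound _ (Real.sqrt_nonneg _) fun x => ?_
      rw [← Real.sqrt_sq (norm_nonneg x), ← Real.sqrt_mul (le_max_right _ _)]
      exact Real.le_sqrt_of_sq_le (hbd x)
    rw [LinearIsometryEquiv.norm_map] at h8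
    exact h8.trans_lt (by rw [Real.sqrt_lt' one_pos]; simpa using hρ1)
  refine ⟨A, K, D, hmat, hA, hKn, hDsa, ?_, ?_⟩
  · exact hDsa.add (by simpa using hAsa.adjoint_conj K)
  · obtain ⟨α, hα, h1⟩ := hF.lower_right
    refine ⟨α, hα, fun y => ?_⟩
    rw [hF.inner_right ht hP hN hmat hA, N.norm_sq_eq]
    have h2 := h1 _ (hN ▸ N.incl_mem y : N.incl y ∈ V)
    rwa [← ht] at h2

end SplitFrame

end

section

/-! ### Enclosure of the non-real spectrum -/

theorem UniformlyPositive.exists_le_norm {E : Type u} [NormedAddCommGroup E]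
    [InnerProductSpace ℂ E] [CompleteSpace E] {T : E →L[ℂ] E} (h : UniformlyPositive T) :
    ∃ c : ℝ, 0 < c ∧ ∀ x, c * ‖x‖ ≤ ‖T x‖ := by
  obtain ⟨-, c, hc, h⟩ := h
  refine ⟨c, hc, fun x => ?_⟩
  rcases (norm_nonneg x).eq_or_lt with h0 | h0
  · rw [← h0, mul_zero]; exact norm_nonneg _
  · have h1 := (h x).trans ((le_abs_self _).trans
      ((Complex.abs_re_le_norm _).trans (norm_inner_le_norm _ _)))
    refine le_of_mul_le_mul_left ?_ h0
    linarith

theorem inner_apply_self_ofReal {E : Type u} [NormedAddCommGroup E]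
    [InnerProductSpace ℂ E] [CompleteSpace E] {T : E →L[ℂ] E} (h : IsSelfAdjoint T) (x : E) :
    (((inner ℂ x (T x)).re : ℝ) : ℂ) = inner ℂ x (T x) := by
  have h1 := (ContinuousLinearMap.isSelfAdjoint_iff_isSymmetric.mp h) x x
  simp only [ContinuousLinearMap.coe_coe] at h1
  have h2 := inner_conj_symm (𝕜 := ℂ) x (T x)
  rw [h1] at h2
  exact Complex.conj_eq_iff_re.mp h2

/-- The scalar relations satisfied, up to the size of the residual, by an approximate
eigenvector of a block operator matrix `[A, -A K; K* A, D]`. -/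
theorem exists_estimate_of_residual {E F : Type u} [NormedAddCommGroup E] [InnerProductSpace ℂ E]
    [CompleteSpace E] [NormedAddCommGroup F] [InnerProductSpace ℂ F] [CompleteSpace F]
    {A : E →L[ℂ] E} {K : F →L[ℂ] E} {D : F →L[ℂ] F} (hA : UniformlyPositive A)
    (hQ : IsSelfAdjoint (D + (ContinuousLinearMap.adjoint K).comp (A.comp K)))
    {α β γ δ : ℝ}
    (hγ : ∀ e, γ * ‖A e‖ ^ 2 ≤ (inner ℂ e (A e)).re)
    (hδ : ∀ e, (inner ℂ e (A e)).re ≤ δ * ‖A e‖ ^ 2)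
    (hα : ∀ y, α * ‖y‖ ^ 2 ≤
      (inner ℂ y ((D + (ContinuousLinearMap.adjoint K).comp (A.comp K)) y)).re)
    (hβ : ∀ y, (inner ℂ y ((D + (ContinuousLinearMap.adjoint K).comp (A.comp K)) y)).re ≤
      β * ‖y‖ ^ 2) (l : ℂ) :
    ∃ M : ℝ, 0 ≤ M ∧ ∀ (u r : E) (v s : F), A u - A (K v) - l • u = r →
      ContinuousLinearMap.adjoint K (A u) + D v - l • v = s → ‖u‖ + ‖v‖ = 1 →
      ∃ p b : ℝ, γ * ‖u‖ ^ 2 ≤ p ∧ p ≤ δ * ‖u‖ ^ 2 ∧ α * ‖v‖ ^ 2 ≤ b ∧ b ≤ β * ‖v‖ ^ 2 ∧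
        ‖(b : ℂ) - l * ((‖v‖ : ℂ) ^ 2 - (‖u‖ : ℂ) ^ 2) - (‖l‖ : ℂ) ^ 2 * p‖ ≤ M * (‖r‖ + ‖s‖) ∧
        ‖(‖u‖ : ℂ) ^ 2 - l * p‖ - ‖K‖ * (‖u‖ * ‖v‖) ≤ M * (‖r‖ + ‖s‖) := by
  obtain ⟨c, hc, hAc⟩ := hA.exists_le_norm
  -- The summands bound the error terms `(v, s)`, `(K v, r)`, `l (d, u)` and `(u, d)` below, where
  -- `d = A⁻¹ r`.
  refine ⟨1 + ‖K‖ + ‖l‖ / c + 1 / c, by positivity, fun u r v s hr hs huv => ?_⟩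
  have hu1 : ‖u‖ ≤ 1 := by linarith [norm_nonneg v]
  have hv1 : ‖v‖ ≤ 1 := by linarith [norm_nonneg u]
  obtain ⟨e, rfl⟩ := hA.surjective u
  set u := A e with hu
  set Q := D + (ContinuousLinearMap.adjoint K).comp (A.comp K) with hQdef
  have hd : ‖u - K v - l • e‖ ≤ ‖r‖ / c := by
    rw [le_div_iff₀ hc, mul_comm, ← hr, hu]
    refine (hAc _).trans (le_of_eq ?_)
    rw [map_sub, map_sub, map_smul]
  set d := u - K v - l • e with hddef
  have hKv : K v = u - l • e - d := by rw [hddef]; abel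
  have hKvn : ‖K v‖ ≤ ‖K‖ * ‖v‖ := K.le_opNorm v
  have hp := inner_apply_self_ofReal hA.1 e
  have hp' : inner ℂ u e = inner ℂ e u := by
    rw [← inner_conj_symm, ← hp, Complex.conj_ofReal]
  have hb := inner_apply_self_ofReal hQ v
  have huu : inner ℂ u u = (‖u‖ : ℂ) ^ 2 := inner_self_eq_norm_sq_to_K u
  have hvv : inner ℂ v v = (‖v‖ : ℂ) ^ 2 := inner_self_eq_norm_sq_to_K v
  have hll : l * conj l = (‖l‖ : ℂ) ^ 2 := by
    rw [Complex.mul_conj, Complex.normSq_eq_norm_sq, Complex.ofReal_pow]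
  have hrn := norm_nonneg r
  have hsn := norm_nonneg s
  have hc1 : ‖r‖ / c = 1 / c * ‖r‖ := by ring
  refine ⟨(inner ℂ e u).re, (inner ℂ v (Q v)).re, hγ e, hδ e, hα v, hβ v, ?_, ?_⟩
  · have h1 : inner ℂ v s = inner ℂ v (Q v) - l * inner ℂ v v + (l * inner ℂ (K v) u +
        inner ℂ (K v) r) := by
      -- Eliminate `D` through `Q`, then `A K v` through the first row.
      have h2 : s = Q v - l • v + ContinuousLinearMap.adjoint K (l • u + r) := by
        rw [← hr, ← hs, hQdef]
        simp only [add_apply, ContinuousLinearMap.comp_apply, map_add, map_sub]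
        abel
      rw [h2, inner_add_right, inner_sub_right, inner_smul_right,
        ContinuousLinearMap.adjoint_inner_right, inner_add_right, inner_smul_right]
    have h2 : inner ℂ (K v) u = (‖u‖ : ℂ) ^ 2 - conj l * inner ℂ e u - inner ℂ d u := by
      rw [hKv, inner_sub_left, inner_sub_left, inner_smul_left, huu]
    have h3 : (((inner ℂ v (Q v)).re : ℝ) : ℂ) - l * ((‖v‖ : ℂ) ^ 2 - (‖u‖ : ℂ) ^ 2) -
        (‖l‖ : ℂ) ^ 2 * (((inner ℂ e u).re : ℝ) : ℂ) =
        inner ℂ v s - inner ℂ (K v) r + l * inner ℂ d u := by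
      rw [hb, hp, h1, h2, hvv, ← hll]
      ring
    rw [h3]
    have h4 : ‖inner ℂ v s‖ ≤ ‖s‖ := (norm_inner_le_norm _ _).trans
      (mul_le_of_le_one_left hsn hv1)
    have h5 : ‖inner ℂ (K v) r‖ ≤ ‖K‖ * ‖r‖ := (norm_inner_le_norm _ _).trans (by
      gcongr
      exact hKvn.trans (mul_le_of_le_one_right (norm_nonneg K) hv1))
    have h6 : ‖l * inner ℂ d u‖ ≤ ‖l‖ / c * ‖r‖ := by
      rw [norm_mul, div_mul_eq_mul_div, mul_div_assoc]
      gcongr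
      exact (norm_inner_le_norm _ _).trans
        ((mul_le_of_le_one_right (norm_nonneg d) hu1).trans hd)
    have h7 := (norm_add_le (inner ℂ v s - inner ℂ (K v) r) (l * inner ℂ d u)).trans
      (add_le_add_left (norm_sub_le _ _) _)
    have h8 : 0 ≤ ‖K‖ * ‖s‖ := by positivity
    have h9 : 0 ≤ ‖l‖ / c * ‖s‖ := by positivity
    have h10 : 0 ≤ 1 / c * (‖r‖ + ‖s‖) := by positivity
    linarith
  · have h1 : (‖u‖ : ℂ) ^ 2 - l * (((inner ℂ e u).re : ℝ) : ℂ) = inner ℂ u (K v + d) := by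
      rw [hp, ← huu, ← hp', ← inner_smul_right, ← inner_sub_right, hKv]
      congr 1
      abel
    rw [h1]
    have h2 : ‖inner ℂ u (K v + d)‖ ≤ ‖u‖ * (‖K‖ * ‖v‖ + ‖r‖ / c) :=
      (norm_inner_le_norm _ _).trans (by
        gcongr
        exact (norm_add_le _ _).trans (add_le_add hKvn hd))
    have h3 : ‖u‖ * (‖r‖ / c) ≤ ‖r‖ / c := mul_le_of_le_one_left (by positivity) hu1
    have h8 : 0 ≤ ‖K‖ * (‖r‖ + ‖s‖) := by positivity
    have h9 : 0 ≤ ‖l‖ / c * (‖r‖ + ‖s‖) := by positivity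
    have h10 : 0 ≤ 1 / c * ‖s‖ := by positivity
    linarith

/-- The scalar relations of an approximate eigenvector persist in the limit, where they confine
a non-real `l`. -/
theorem exists_of_approximate {k α β γ δ : ℝ} {l : ℂ} (hl : l.im ≠ 0)
    (hα : 0 < α) (hβ : 0 < β) (hγ : 0 < γ) (hδ : 0 < δ)
    (h : ∀ ε : ℝ, 0 < ε → ∃ u v p b : ℝ, 0 ≤ u ∧ 0 ≤ v ∧ u + v = 1 ∧
      γ * u ^ 2 ≤ p ∧ p ≤ δ * u ^ 2 ∧ α * v ^ 2 ≤ b ∧ b ≤ β * v ^ 2 ∧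
      ‖(b : ℂ) - l * ((v : ℂ) ^ 2 - (u : ℂ) ^ 2) - (‖l‖ : ℂ) ^ 2 * p‖ ≤ ε ∧
      ‖(u : ℂ) ^ 2 - l * p‖ - k * (u * v) ≤ ε) :
    ∃ p : ℝ, γ ≤ p ∧ p ≤ δ ∧ α ≤ ‖l‖ ^ 2 * p ∧ ‖l‖ ^ 2 * p ≤ β ∧ ‖1 - l * p‖ ≤ k := by
  set T : Set (ℝ × ℝ × ℝ × ℝ) := {x | 0 ≤ x.1 ∧ 0 ≤ x.2.1 ∧ x.1 + x.2.1 = 1 ∧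
      γ * x.1 ^ 2 ≤ x.2.2.1 ∧ x.2.2.1 ≤ δ * x.1 ^ 2 ∧
      α * x.2.1 ^ 2 ≤ x.2.2.2 ∧ x.2.2.2 ≤ β * x.2.1 ^ 2} with hT
  set φ : ℝ × ℝ × ℝ × ℝ → ℝ := fun x =>
    max ‖(x.2.2.2 : ℂ) - l * ((x.2.1 : ℂ) ^ 2 - (x.1 : ℂ) ^ 2) - (‖l‖ : ℂ) ^ 2 * (x.2.2.1 : ℂ)‖
      (‖(x.1 : ℂ) ^ 2 - l * (x.2.2.1 : ℂ)‖ - k * (x.1 * x.2.1)) with hφ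
  have hTc : IsCompact T := by
    refine IsCompact.of_isClosed_subset
      (isCompact_Icc.prod (isCompact_Icc.prod (isCompact_Icc.prod isCompact_Icc)) :
        IsCompact (Set.Icc (0 : ℝ) 1 ×ˢ Set.Icc (0 : ℝ) 1 ×ˢ Set.Icc 0 δ ×ˢ Set.Icc 0 β)) ?_ ?_
    · simp only [hT, Set.ofPred_and]
      refine ((isClosed_le ?_ ?_).inter ((isClosed_le ?_ ?_).inter ((isClosed_eq ?_ ?_).inter
        ((isClosed_le ?_ ?_).inter ((isClosed_le ?_ ?_).inter ((isClosed_le ?_ ?_).inter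
          (isClosed_le ?_ ?_))))))) <;> fun_prop
    · rintro ⟨u, v, p, b⟩ ⟨h1, h2, h3, h4, h5, h6, h7⟩
      simp only at h1 h2 h3 h4 h5 h6 h7
      have hu : u ^ 2 ≤ 1 := pow_le_one₀ h1 (by linarith)
      have hv : v ^ 2 ≤ 1 := pow_le_one₀ h2 (by linarith)
      refine ⟨⟨h1, by linarith⟩, ⟨h2, by linarith⟩, ⟨?_, ?_⟩, ⟨?_, ?_⟩⟩ <;> simp only
      · exact le_trans (by positivity) h4
      · exact h5.trans (mul_le_of_le_one_right hδ.le hu)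
      · exact le_trans (by positivity) h6
      · exact h7.trans (mul_le_of_le_one_right hβ.le hv)
  have hex : ∀ ε : ℝ, 0 < ε → ∃ x ∈ T, φ x ≤ ε := fun ε hε => by
    obtain ⟨u, v, p, b, h1, h2, h3, h4, h5, h6, h7, h8, h9⟩ := h ε hε
    exact ⟨(u, v, p, b), ⟨h1, h2, h3, h4, h5, h6, h7⟩, max_le h8 h9⟩
  have hφc : Continuous φ := by
    rw [hφ]
    fun_prop
  obtain ⟨x₁, hx₁, -⟩ := hex 1 one_pos
  -- The defect `φ` attains its minimum on the compact set `T`; as it takes values below every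
  -- positive number there, some point satisfies the limiting relations exactly.
  obtain ⟨x, hx, hmin⟩ := hTc.exists_isMinOn ⟨x₁, hx₁⟩ hφc.continuousOn
  have hφx : φ x ≤ 0 := by
    by_contra! h0
    obtain ⟨y, hy, hy'⟩ := hex (φ x / 2) (half_pos h0)
    have h1 : φ x ≤ φ y := hmin hy
    linarith
  obtain ⟨u, v, p, b⟩ := x
  obtain ⟨hu, hv, huv, hp1, hp2, hb1, hb2⟩ := hx
  simp only at hu hv huv hp1 hp2 hb1 hb2
  have h1 := norm_le_zero_iff.mp ((le_max_left _ _).trans hφx)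
  have h2 := (le_max_right _ _).trans hφx
  simp only at h1 h2
  have him := congrArg Complex.im h1
  have hre := congrArg Complex.re h1
  simp [← Complex.ofReal_pow] at him hre
  -- The only use of `l` being non-real. With `u + v = 1` it gives `u = v = 1/2`, whence the
  -- rescaling of `p` by `4 = 1 / u²`.
  have huv' : v ^ 2 - u ^ 2 = 0 := him.resolve_left hl
  have hvu : v = u := by nlinarith
  subst hvu
  have hv2 : v = 1 / 2 := by linarith
  subst hv2
  rw [sub_self, mul_zero, sub_zero] at hre
  refine ⟨4 * p, by linarith, by linarith, by linarith, by linarith, ?_⟩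
  have h3 : (1 : ℂ) - l * ((4 * p : ℝ) : ℂ) = 4 * ((((1 / 2 : ℝ) : ℂ)) ^ 2 - l * p) := by
    push_cast
    ring
  rw [h3, norm_mul]
  norm_num at h2 ⊢
  linarith

variable {H : Type u} [NormedAddCommGroup H] [InnerProductSpace ℂ H] [CompleteSpace H]

/-- The lower bound for `T` gives injectivity and closed range. If `z` is Hilbert-orthogonal to the
range, then `T' (J z) = 0`, so the lower bound for `T'` gives `z = 0`. -/
theorem isUnit_of_form_adjoint {J : FundamentalSymmetry H} {T T' : H →L[ℂ] H}
    (hTT' : ∀ x y, form J (T x) y = form J x (T' y)) {c : ℝ} (hc : 0 < c)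
    (hT : ∀ x, c * ‖x‖ ≤ ‖T x‖) (hT' : ∀ x, c * ‖x‖ ≤ ‖T' x‖) : IsUnit T := by
  have hanti : AntilipschitzWith (Real.toNNReal c⁻¹) T :=
    ContinuousLinearMap.antilipschitz_of_bound T fun z => by
      rw [Real.coe_toNNReal _ (by positivity), ← div_eq_inv_mul, le_div_iff₀ hc, mul_comm]
      exact hT z
  rw [ContinuousLinearMap.isUnit_iff_bijective]
  refine ⟨hanti.injective, ?_⟩
  have hcl : IsClosed (LinearMap.range (T : H →ₗ[ℂ] H) : Set H) :=
    hanti.isClosed_range T.uniformContinuous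
  have : LinearMap.range (T : H →ₗ[ℂ] H) = ⊤ := by
    rw [← hcl.submodule_topologicalClosure_eq, Submodule.topologicalClosure_eq_top_iff,
      Submodule.eq_bot_iff]
    intro z hz
    have h1 : T' (J.op z) = 0 := by
      refine eq_zero_of_form_eq_zero J fun y => form_eq_zero_comm ?_
      rw [← hTT', form, inner_op_op, ← inner_conj_symm,
        (Submodule.mem_orthogonal _ z).mp hz (T y) ⟨y, rfl⟩, map_zero]
    have h2 := hT' (J.op z)
    rw [h1, norm_zero, norm_op_apply] at h2
    have h3 := norm_nonneg z
    exact norm_le_zero_iff.mp (by nlinarith)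
  exact LinearMap.range_eq_top.mp this

end

section

/-! ### Discs and sectors -/

theorem mem_discUnion {k γ δ p : ℝ} {l : ℂ} (hγ : 0 < γ) (h1 : γ ≤ p) (h2 : p ≤ δ)
    (h : ‖1 - l * p‖ ≤ k) : l ∈ discUnion k δ⁻¹ γ⁻¹ := by
  have hp : 0 < p := hγ.trans_le h1
  have hpc : (p : ℂ) ≠ 0 := by exact_mod_cast hp.ne'
  simp only [discUnion, Set.mem_iUnion]
  refine ⟨p⁻¹, ⟨inv_anti₀ hp h2, inv_anti₀ hγ h1⟩, ?_⟩
  rw [Metric.mem_closedBall, dist_eq_norm]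
  have h3 : l - ((p⁻¹ : ℝ) : ℂ) = -((p⁻¹ : ℝ) : ℂ) * (1 - l * p) := by
    push_cast
    field_simp
    ring
  rw [h3, norm_mul, norm_neg, Complex.norm_real, Real.norm_of_nonneg (inv_pos.mpr hp).le]
  gcongr

theorem norm_sub_ofReal_sq (l : ℂ) (c : ℝ) :
    ‖l - (c : ℂ)‖ ^ 2 = ‖l‖ ^ 2 - 2 * c * l.re + c ^ 2 := by
  rw [← Complex.normSq_eq_norm_sq, ← Complex.normSq_eq_norm_sq, Complex.normSq_apply,
    Complex.normSq_apply]
  simp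
  ring

/-- Put `b = |l|² p`. Multiplying `|1 - l p|² ≤ k²` by `|l|²` gives `(1 - k²)|l|² - 2 b Re l + b² ≤
0`; completing the square gives the disc. -/
theorem mem_discUnion' {k α β p : ℝ} {l : ℂ} (hk : k < 1) (hα : 0 < α)
    (h1 : α ≤ ‖l‖ ^ 2 * p) (h2 : ‖l‖ ^ 2 * p ≤ β) (h : ‖1 - l * p‖ ≤ k) :
    l ∈ discUnion' k α β := by
  have hk0 : 0 ≤ k := (norm_nonneg _).trans h
  have hk2 : 0 < 1 - k ^ 2 := by nlinarith
  simp only [discUnion', Set.mem_iUnion]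
  refine ⟨‖l‖ ^ 2 * p, ⟨h1, h2⟩, ?_⟩
  have hb : 0 < ‖l‖ ^ 2 * p := hα.trans_le h1
  rw [Metric.mem_closedBall, dist_eq_norm]
  refine abs_le_of_sq_le_sq' ?_ (by positivity) |>.2
  rw [norm_sub_ofReal_sq]
  have h3 : 1 - 2 * p * l.re + p ^ 2 * ‖l‖ ^ 2 ≤ k ^ 2 := by
    have h4 : ‖1 - l * p‖ ^ 2 ≤ k ^ 2 := by gcongr
    have h5 : ‖1 - l * p‖ ^ 2 = 1 - 2 * p * l.re + p ^ 2 * ‖l‖ ^ 2 := by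
      rw [← Complex.normSq_eq_norm_sq, ← Complex.normSq_eq_norm_sq, Complex.normSq_apply,
        Complex.normSq_apply]
      simp
      ring
    linarith
  have h4 : ‖l‖ ^ 2 * p * k / (1 - k ^ 2) = (‖l‖ ^ 2 * p / (1 - k ^ 2)) * k := by ring
  rw [h4]
  set c := ‖l‖ ^ 2 * p / (1 - k ^ 2) with hc
  have h5 : c * (1 - k ^ 2) = ‖l‖ ^ 2 * p := div_mul_cancel₀ _ hk2.ne'
  have h6 : ‖l‖ ^ 2 * (1 - 2 * p * l.re + p ^ 2 * ‖l‖ ^ 2 - k ^ 2) ≤ 0 :=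
    mul_nonpos_of_nonneg_of_nonpos (by positivity) (by linarith)
  have h7 : (1 - k ^ 2) * (‖l‖ ^ 2 - 2 * c * l.re + c ^ 2 - (c * k) ^ 2) =
      ‖l‖ ^ 2 * (1 - 2 * p * l.re + p ^ 2 * ‖l‖ ^ 2 - k ^ 2) := by
    linear_combination (c * (1 - k ^ 2) + ‖l‖ ^ 2 * p - 2 * l.re) * h5
  rw [← h7] at h6
  have h8 := nonpos_of_mul_nonpos_right h6 hk2
  linarith

theorem discUnion_subset_sector {k lo hi : ℝ} (hk0 : 0 ≤ k) (hk : k < 1) (hlo : 0 < lo) :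
    discUnion k lo hi ⊆ sector (Real.arcsin k) := by
  intro z hz
  simp only [discUnion, Set.mem_iUnion] at hz
  obtain ⟨a, ⟨ha, -⟩, hz⟩ := hz
  have ha0 : 0 < a := hlo.trans_le ha
  rw [Metric.mem_closedBall, dist_eq_norm] at hz
  have hre : 0 < z.re := by
    have h1 := (Complex.abs_re_le_norm _).trans hz
    rw [Complex.sub_re, Complex.ofReal_re] at h1
    have h2 := (abs_le.mp h1).1
    have h3 : a * k < a * 1 := by gcongr
    linarith
  have hk2 : 0 < 1 - k ^ 2 := by nlinarith
  refine ⟨hre, ?_⟩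
  rw [Real.tan_arcsin, div_mul_eq_mul_div, le_div_iff₀ (Real.sqrt_pos.mpr hk2)]
  refine abs_le_of_sq_le_sq' ?_ (by positivity) |>.2
  rw [mul_pow, Real.sq_sqrt hk2.le, sq_abs]
  have h1 : ‖z - (a : ℂ)‖ ^ 2 ≤ (a * k) ^ 2 := by gcongr
  rw [← Complex.normSq_eq_norm_sq, Complex.normSq_apply] at h1
  simp only [Complex.sub_re, Complex.sub_im, Complex.ofReal_re, Complex.ofReal_im] at h1
  -- The slack is exactly this square: the disc touches the sector's boundary where `Re z = a (1 -
  -- k²)`.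
  nlinarith [sq_nonneg (z.re - a * (1 - k ^ 2)), mul_le_mul_of_nonneg_left h1 hk2.le]

/-! ### Invertibility and spectral enclosure for a split frame -/

variable {H : Type u} [NormedAddCommGroup H] [InnerProductSpace ℂ H] [CompleteSpace H]

namespace SplitFrame

variable {J : FundamentalSymmetry H} {s t : ℝ} {U V : Submodule ℂ H}
  {κ μ : Type v} {g : κ → H} {h : μ → H} {S : H →L[ℂ] H}
  {P : HilbertSubspace J s} {N : HilbertSubspace J t}
  {A : P.Carrier →L[ℂ] P.Carrier} {K : N.Carrier →L[ℂ] P.Carrier}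
  {D : N.Carrier →L[ℂ] N.Carrier}

/-- On `e` and `K y + y` the operator is triangular, with diagonal `A` and `Q`, hence surjective.
Symmetry and non-degeneracy of the form turn this into injectivity. -/
theorem isUnit (hF : SplitFrame J s U V g h S) (hP : P.space = orth J V) (hN : N.space = V)
    (hrep : BlockRep P N S A K D) : IsUnit S := by
  have hsurj : Function.Surjective S := by
    intro z
    obtain ⟨r, w, rfl⟩ := hF.exists_eq_add hP hN z
    obtain ⟨e, rfl⟩ := hrep.uniformlyPositive.surjective r
    obtain ⟨y, hy⟩ := hrep.uniformlyPositive_schur.surjective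
      (w - ContinuousLinearMap.adjoint K (A e))
    refine ⟨(P.incl (K y) + N.incl y) + P.incl e, ?_⟩
    have h1 := hrep.matrix e 0
    simp only [map_zero, add_zero, sub_zero] at h1
    rw [map_add, apply_angular hrep.matrix, hy, h1, map_sub]
    abel
  rw [ContinuousLinearMap.isUnit_iff_bijective]
  refine ⟨?_, hsurj⟩
  rw [injective_iff_map_eq_zero]
  intro x hx
  refine eq_zero_of_form_eq_zero J fun y => ?_
  obtain ⟨z, rfl⟩ := hsurj y
  rw [← hF.form_apply_comm, hx, form_zero_left]

/-- Solving `Q y = K* A e` gives `A e = S (e - (K y + y))`. Hence `[A e, S⁻¹ gᵢ] = [e - (K y + y),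
gᵢ] = [e, gᵢ]`. -/
theorem inner_left_eq_dual (hF : SplitFrame J s U V g h S) (ht : t = -s)
    (hP : P.space = orth J V) (hN : N.space = V) (hrep : BlockRep P N S A K D) (e : P.Carrier) :
    (inner ℂ e (A e)).re = ∑' i, ‖form J (P.incl (A e)) (Ring.inverse S (g i))‖ ^ 2 := by
  rw [hF.inner_left hP hN hrep.matrix]
  congr 1
  ext i
  congr 2
  obtain ⟨y, hy⟩ := hrep.uniformlyPositive_schur.surjective
    (ContinuousLinearMap.adjoint K (A e))
  have h1 := hrep.matrix e 0
  simp only [map_zero, add_zero, sub_zero] at h1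
  have h2 : P.incl (A e) = S (P.incl e - (P.incl (K y) + N.incl y)) := by
    rw [map_sub, apply_angular hrep.matrix, hy, h1]
    abel
  have h3 : S (Ring.inverse S (g i)) = g i := by
    have := congrArg (fun L : H →L[ℂ] H => L (g i))
      (Ring.mul_inverse_cancel S (hF.isUnit hP hN hrep))
    simpa using this
  rw [h2, hF.form_apply_comm, h3, form_sub_left,
    hF.angular_mem_orth ht hP hN hrep.matrix hrep.uniformlyPositive y _ (hF.left_mem i), sub_zero]

theorem exists_of_approximate_eigenvalue (hF : SplitFrame J s U V g h S) (ht : t = -s)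
    (hP : P.space = orth J V) (hN : N.space = V) (hrep : BlockRep P N S A K D)
    {α β γ δ : ℝ} (hα : IsLowerFrameBound J t h V α) (hβ : IsUpperFrameBound J t h V β)
    (hγ : IsLowerFrameBound J s (fun i => Ring.inverse S (g i)) (orth J V) γ)
    (hδ : IsUpperFrameBound J s (fun i => Ring.inverse S (g i)) (orth J V) δ)
    {l : ℂ} (hl : l.im ≠ 0) (hap : ∀ c : ℝ, 0 < c → ∃ x, ‖S x - l • x‖ < c * ‖x‖) :
    ∃ p : ℝ, γ ≤ p ∧ p ≤ δ ∧ α ≤ ‖l‖ ^ 2 * p ∧ ‖l‖ ^ 2 * p ≤ β ∧ ‖1 - l * p‖ ≤ ‖K‖ := by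
  have hPd : UniformlyDefinite J s P.space := hP ▸ hF.definite_orth
  have hVd : UniformlyDefinite J t V := ht ▸ hF.definite_right
  have hNd : UniformlyDefinite J t N.space := hN ▸ hVd
  obtain ⟨M, hM, hest⟩ := exists_estimate_of_residual hrep.uniformlyPositive
    hrep.uniformlyPositive_schur.1 (α := α) (β := β) (γ := γ) (δ := δ)
    (fun e => by
      rw [hF.inner_left_eq_dual ht hP hN hrep, P.norm_sq_eq]
      exact (hγ.2 _ (hP ▸ P.incl_mem (A e))).2)
    (fun e => by
      rw [hF.inner_left_eq_dual ht hP hN hrep, P.norm_sq_eq]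
      exact (hδ.2 _ (hP ▸ P.incl_mem (A e))).2)
    (fun y => by
      rw [hF.inner_right ht hP hN hrep.matrix hrep.uniformlyPositive, N.norm_sq_eq]
      exact (hα.2 _ (hN ▸ N.incl_mem y)).2)
    (fun y => by
      rw [hF.inner_right ht hP hN hrep.matrix hrep.uniformlyPositive, N.norm_sq_eq]
      exact (hβ.2 _ (hN ▸ N.incl_mem y)).2) l
  refine exists_of_approximate hl hα.1 hβ.1 hγ.1 hδ.1 fun ε hε => ?_
  set c₁ := ‖P.proj hPd‖ + ‖N.proj hNd‖ with hc₁
  set c₂ := ‖P.inclL hPd‖ + ‖N.inclL hNd‖ with hc₂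
  have hc₁0 : 0 ≤ c₁ := by positivity
  have hc₂0 : 0 ≤ c₂ := by positivity
  -- The factors `c₁`, `c₂` convert between the ambient norm and the intrinsic norms of the
  -- components, and `M` comes from the residual estimate.
  set η := ε / (M * (c₁ * c₂) + 1) with hη
  have hη0 : 0 < η := by positivity
  obtain ⟨x, hx⟩ := hap η hη0
  obtain ⟨u, v, rfl⟩ := hF.exists_eq_add hP hN x
  set n := ‖u‖ + ‖v‖ with hn
  have hn0 : 0 < n := by
    refine lt_of_le_of_ne (by positivity) fun h0 => ?_
    have hu : u = 0 := norm_eq_zero.mp (by linarith [norm_nonneg u, norm_nonneg v])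
    have hv : v = 0 := norm_eq_zero.mp (by linarith [norm_nonneg u, norm_nonneg v])
    simp [hu, hv] at hx
  have hxn : ‖P.incl u + N.incl v‖ ≤ c₂ * n := by
    have h1 := (P.inclL hPd).le_opNorm u
    have h2 := (N.inclL hNd).le_opNorm v
    rw [HilbertSubspace.inclL_apply] at h1 h2
    refine (norm_add_le _ _).trans ((add_le_add h1 h2).trans ?_)
    have h3 : 0 ≤ ‖P.inclL hPd‖ * ‖v‖ := by positivity
    have h4 : 0 ≤ ‖N.inclL hNd‖ * ‖u‖ := by positivity
    rw [hc₂, hn]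
    linarith
  set w := ((n⁻¹ : ℝ) : ℂ) • (S (P.incl u + N.incl v) - l • (P.incl u + N.incl v)) with hw
  have hninv : ‖((n⁻¹ : ℝ) : ℂ)‖ = n⁻¹ := by
    rw [Complex.norm_real, Real.norm_of_nonneg (inv_pos.mpr hn0).le]
  have hwn : ‖w‖ ≤ η * c₂ := by
    rw [hw, norm_smul, hninv, inv_mul_le_iff₀ hn0]
    have h1 := hx.le.trans (mul_le_mul_of_nonneg_left hxn hη0.le)
    linarith
  set u' := ((n⁻¹ : ℝ) : ℂ) • u with hu'
  set v' := ((n⁻¹ : ℝ) : ℂ) • v with hv'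
  have hw' : w = P.incl (A u' - A (K v') - l • u') +
      N.incl (ContinuousLinearMap.adjoint K (A u') + D v' - l • v') := by
    have h1 := hrep.matrix u' v'
    have h2 : P.incl u' + N.incl v' = ((n⁻¹ : ℝ) : ℂ) • (P.incl u + N.incl v) := by
      rw [hu', hv', map_smul, map_smul, smul_add]
    rw [map_sub P.incl, map_sub N.incl, map_smul P.incl, map_smul N.incl, hw, smul_sub,
      smul_comm, ← map_smul, ← h2, h1, smul_add]
    abel
  have hnorm : ‖u'‖ + ‖v'‖ = 1 := by
    rw [hu', hv', norm_smul, norm_smul, hninv, ← mul_add, ← hn, inv_mul_cancel₀ hn0.ne']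
  have hr : A u' - A (K v') - l • u' = P.proj hPd w := by rw [hw', proj_left hP hN]
  have hs : ContinuousLinearMap.adjoint K (A u') + D v' - l • v' = N.proj hNd w := by
    rw [hw', proj_right hP hN]
  obtain ⟨p, b, h1, h2, h3, h4, h5, h6⟩ := hest u' _ v' _ hr hs hnorm
  have hsmall : M * (‖P.proj hPd w‖ + ‖N.proj hNd w‖) ≤ ε := by
    have h7 : ‖P.proj hPd w‖ + ‖N.proj hNd w‖ ≤ c₁ * (η * c₂) :=
      (add_le_add ((P.proj hPd).le_opNorm w) ((N.proj hNd).le_opNorm w)).trans (by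
        rw [← add_mul]
        gcongr)
    have h8 : η * (M * (c₁ * c₂) + 1) = ε := div_mul_cancel₀ _ (by positivity)
    calc M * (‖P.proj hPd w‖ + ‖N.proj hNd w‖) ≤ M * (c₁ * (η * c₂)) := by gcongr
      _ ≤ ε := by linarith
  exact ⟨‖u'‖, ‖v'‖, p, b, norm_nonneg _, norm_nonneg _, hnorm, h1, h2, h3, h4,
    h5.trans hsmall, h6.trans hsmall⟩

/-- If neither `l` nor its conjugate is an approximate eigenvalue, then `l - S` and its form-adjoint
are bounded below, so `l` is in the resolvent set. -/
theorem spectrum_subset (hF : SplitFrame J s U V g h S) (ht : t = -s)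
    (hP : P.space = orth J V) (hN : N.space = V) (hrep : BlockRep P N S A K D)
    {α β γ δ : ℝ} (hα : IsLowerFrameBound J t h V α) (hβ : IsUpperFrameBound J t h V β)
    (hγ : IsLowerFrameBound J s (fun i => Ring.inverse S (g i)) (orth J V) γ)
    (hδ : IsUpperFrameBound J s (fun i => Ring.inverse S (g i)) (orth J V) δ) :
    spectrum ℂ S \ Set.range ((↑) : ℝ → ℂ) ⊆
      discUnion ‖K‖ δ⁻¹ γ⁻¹ ∩ discUnion' ‖K‖ α β := by
  rintro l ⟨hl, hreal⟩
  have him : l.im ≠ 0 := fun h0 => hreal ⟨l.re, Complex.ext rfl h0.symm⟩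
  suffices hp : ∃ p : ℝ, γ ≤ p ∧ p ≤ δ ∧ α ≤ ‖l‖ ^ 2 * p ∧ ‖l‖ ^ 2 * p ≤ β ∧
      ‖1 - l * p‖ ≤ ‖K‖ by
    obtain ⟨p, h1, h2, h3, h4, h5⟩ := hp
    exact ⟨mem_discUnion hγ.1 h1 h2 h5, mem_discUnion' hrep.norm_lt_one hα.1 h3 h4 h5⟩
  by_cases hap : ∀ c : ℝ, 0 < c → ∃ x, ‖S x - l • x‖ < c * ‖x‖
  · exact hF.exists_of_approximate_eigenvalue ht hP hN hrep hα hβ hγ hδ him hap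
  by_cases hap' : ∀ c : ℝ, 0 < c → ∃ x, ‖S x - conj l • x‖ < c * ‖x‖
  · obtain ⟨p, h1, h2, h3, h4, h5⟩ := hF.exists_of_approximate_eigenvalue ht hP hN hrep
      hα hβ hγ hδ (l := conj l) (by simpa using him) hap'
    rw [RCLike.norm_conj] at h3 h4
    refine ⟨p, h1, h2, h3, h4, ?_⟩
    rwa [← RCLike.norm_conj, map_sub, map_mul, map_one, Complex.conj_ofReal]
  exfalso
  push Not at hap hap'
  obtain ⟨c, hc, h1⟩ := hap
  obtain ⟨d, hd, h2⟩ := hap'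
  refine hl (isUnit_of_form_adjoint (J := J) (T' := algebraMap ℂ (H →L[ℂ] H) (conj l) - S)
    (fun x y => ?_) (lt_min hc hd) (fun x => ?_) (fun x => ?_))
  · simp only [sub_apply, ContinuousLinearMap.algebraMap_apply,
      form_sub_left, form_sub_right, form_smul_left, form_smul_right, Complex.conj_conj,
      hF.form_apply_comm]
  · rw [sub_apply, ContinuousLinearMap.algebraMap_apply, norm_sub_rev]
    exact (mul_le_mul_of_nonneg_right (min_le_left _ _) (norm_nonneg _)).trans (h1 x)
  · rw [sub_apply, ContinuousLinearMap.algebraMap_apply, norm_sub_rev]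
    exact (mul_le_mul_of_nonneg_right (min_le_right _ _) (norm_nonneg _)).trans (h2 x)

end SplitFrame

end

section

variable {H : Type u} [NormedAddCommGroup H] [InnerProductSpace ℂ H] [CompleteSpace H]
variable {J : FundamentalSymmetry H} {ι : Type v} {f : ι → H} {S : H →L[ℂ] H}

/-! ### J-frames -/

theorem mem_spanPos (i : posIdx J f) : f i ∈ spanPos J f :=
  Submodule.le_topologicalClosure _ (Submodule.subset_span ⟨i, i.2, rfl⟩)

theorem mem_spanNeg (i : negIdx J f) : f i ∈ spanNeg J f :=
  Submodule.le_topologicalClosure _ (Submodule.subset_span ⟨i, i.2, rfl⟩)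

theorem isClosed_spanPos : IsClosed (spanPos J f : Set H) :=
  Submodule.isClosed_topologicalClosure _

theorem isClosed_spanNeg : IsClosed (spanNeg J f : Set H) :=
  Submodule.isClosed_topologicalClosure _

theorem negIdx_eq_compl : negIdx J f = (posIdx J f)ᶜ := by
  ext i
  simp [negIdx, posIdx]

/-- Apply the frame inequality to `J x`: its coefficients are the `[x, fᵢ]`, and `J` is isometric.
-/
theorem IsFrame.exists_form_bounds (hf : IsFrame f) (J : FundamentalSymmetry H) :
    ∃ α β : ℝ, 0 < α ∧ 0 < β ∧ ∀ x,
      α * ‖x‖ ^ 2 ≤ ∑' i : posIdx J f, ‖form J x (f i)‖ ^ 2 +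
        ∑' i : negIdx J f, ‖form J x (f i)‖ ^ 2 ∧
      ∑' i : posIdx J f, ‖form J x (f i)‖ ^ 2 ≤ β * ‖x‖ ^ 2 ∧
      ∑' i : negIdx J f, ‖form J x (f i)‖ ^ 2 ≤ β * ‖x‖ ^ 2 := by
  obtain ⟨α, β, hα, hαβ, h⟩ := hf
  refine ⟨α, β, hα, hα.trans_le hαβ, fun x => ?_⟩
  obtain ⟨hs, h1, h2⟩ := h (J.op x)
  rw [norm_op_apply] at h1 h2
  have hnn : ∀ i, 0 ≤ ‖form J x (f i)‖ ^ 2 := fun i => by positivity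
  have hs' : Summable fun i => ‖form J x (f i)‖ ^ 2 := hs
  refine ⟨?_, ?_, ?_⟩
  · rw [negIdx_eq_compl, hs'.tsum_subtype_add_tsum_subtype_compl]
    exact h1
  · exact (Summable.tsum_subtype_le _ _ hnn hs').trans h2
  · exact (Summable.tsum_subtype_le _ _ hnn hs').trans h2

theorem IsJFrame.uniformlyDefinite_pos (hf : IsJFrame J f) :
    UniformlyDefinite J 1 (spanPos J f) := by
  obtain ⟨_, B, -, hB, h⟩ := hf.isFrame.exists_form_bounds J
  obtain ⟨_, _, -, h1, h2⟩ := hf.bounds_pos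
  exact uniformlyDefinite_of_bounds (by norm_num) isClosed_spanPos mem_spanPos
    hf.nondegenerate_pos h1 h2 hB fun x => (h x).2.1

theorem IsJFrame.uniformlyDefinite_neg (hf : IsJFrame J f) :
    UniformlyDefinite J (-1) (spanNeg J f) := by
  obtain ⟨_, B, -, hB, h⟩ := hf.isFrame.exists_form_bounds J
  obtain ⟨_, _, -, h1, h2⟩ := hf.bounds_neg
  exact uniformlyDefinite_of_bounds (by norm_num) isClosed_spanNeg mem_spanNeg
    hf.nondegenerate_neg h1 h2 hB fun x => (h x).2.2

/-- The sum is closed. A vector orthogonal to it has only zero frame coefficients, so the lower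
frame bound kills it. -/
theorem IsJFrame.sup_eq_top (hf : IsJFrame J f) : spanPos J f ⊔ spanNeg J f = ⊤ := by
  have hcl := isClosed_sup (by norm_num) isClosed_spanPos isClosed_spanNeg
    hf.uniformlyDefinite_pos hf.uniformlyDefinite_neg
  obtain ⟨α, _, hα, -, h⟩ := hf.isFrame.exists_form_bounds J
  rw [← hcl.submodule_topologicalClosure_eq, Submodule.topologicalClosure_eq_top_iff,
    Submodule.eq_bot_iff]
  intro z hz
  have hz' : ∀ y ∈ spanPos J f ⊔ spanNeg J f, form J (J.op z) y = 0 := fun y hy => by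
    rw [form_op_left]
    exact (Submodule.mem_orthogonal _ z).mp hz y hy
  have h1 := (h (J.op z)).1
  simp only [fun i : posIdx J f => hz' _ (Submodule.mem_sup_left (mem_spanPos i)),
    fun i : negIdx J f => hz' _ (Submodule.mem_sup_right (mem_spanNeg i)), norm_op_apply] at h1
  by_contra h0
  have := norm_pos_iff.mpr h0
  have h2 : 0 < α * ‖z‖ ^ 2 := by positivity
  simp at h1
  linarith

theorem IsJFrame.splitFrame_pos (hf : IsJFrame J f) (hS : IsJFrameOperator J f S) :
    SplitFrame J 1 (spanPos J f) (spanNeg J f) (fun i : posIdx J f => f i)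
      (fun i : negIdx J f => f i) S where
  sign := by norm_num
  closed_left := isClosed_spanPos
  closed_right := isClosed_spanNeg
  left_mem := mem_spanPos
  right_mem := mem_spanNeg
  definite_left := hf.uniformlyDefinite_pos
  definite_right := hf.uniformlyDefinite_neg
  sup_eq_top := hf.sup_eq_top
  lower_left := by
    obtain ⟨α, _, hα, -, h⟩ := hf.isFrame.exists_form_bounds J
    refine ⟨α, hα, fun x hx => ?_⟩
    simpa [fun i => hx _ (mem_spanNeg i)] using (h x).1
  lower_right := by
    obtain ⟨α, _, -, h1, -⟩ := hf.bounds_neg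
    exact ⟨α, h1.1, fun x hx => (h1.2 x hx).2⟩
  sum x := by
    obtain ⟨p, q, hp, hq, h⟩ := hS x
    exact ⟨p, q, hp, hq, by rw [h, Complex.ofReal_one, one_smul]⟩

theorem IsJFrame.splitFrame_neg (hf : IsJFrame J f) (hS : IsJFrameOperator J f S) :
    SplitFrame J (-1) (spanNeg J f) (spanPos J f) (fun i : negIdx J f => f i)
      (fun i : posIdx J f => f i) S where
  sign := by norm_num
  closed_left := isClosed_spanNeg
  closed_right := isClosed_spanPos
  left_mem := mem_spanNeg
  right_mem := mem_spanPos
  definite_left := hf.uniformlyDefinite_neg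
  definite_right := by rw [neg_neg]; exact hf.uniformlyDefinite_pos
  sup_eq_top := by rw [sup_comm]; exact hf.sup_eq_top
  lower_left := by
    obtain ⟨α, _, hα, -, h⟩ := hf.isFrame.exists_form_bounds J
    refine ⟨α, hα, fun x hx => ?_⟩
    simpa [fun i => hx _ (mem_spanPos i)] using (h x).1
  lower_right := by
    obtain ⟨α, _, -, h1, -⟩ := hf.bounds_pos
    refine ⟨α, h1.1, fun x hx => ?_⟩
    rw [neg_neg]
    exact (h1.2 x hx).2
  sum x := by
    obtain ⟨p, q, hp, hq, h⟩ := hS x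
    refine ⟨q, p, hq, hp, ?_⟩
    rw [h, Complex.ofReal_neg, Complex.ofReal_one, neg_one_smul, neg_sub]

/-- The fundamental decomposition `H = M₋^[⊥] [∔] M₋`. -/
def IsJFrame.decompositionNeg (hf : IsJFrame J f) (hS : IsJFrameOperator J f S) :
    FundamentalDecomposition J where
  plus := HilbertSubspace.ofClosed (orth J (spanNeg J f)) (isClosed_orth J _)
    (hf.splitFrame_pos hS).definite_orth
  minus := HilbertSubspace.ofClosed (spanNeg J f) isClosed_spanNeg hf.uniformlyDefinite_neg
  isCompl := (hf.splitFrame_pos hS).isCompl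
  orthogonal _ hx y hy := hx y hy

/-- The fundamental decomposition `H = M₊ [∔] M₊^[⊥]`. -/
def IsJFrame.decompositionPos (hf : IsJFrame J f) (hS : IsJFrameOperator J f S) :
    FundamentalDecomposition J where
  plus := HilbertSubspace.ofClosed (spanPos J f) isClosed_spanPos hf.uniformlyDefinite_pos
  minus := HilbertSubspace.ofClosed (orth J (spanPos J f)) (isClosed_orth J _)
    (hf.splitFrame_neg hS).definite_orth
  isCompl := (hf.splitFrame_neg hS).isCompl.symm
  orthogonal x hx _ hy := form_eq_zero_comm (hy x hx)

variable {𝒟 : FundamentalDecomposition J}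

theorem representedWithK_iff {A : 𝒟.plus.Carrier →L[ℂ] 𝒟.plus.Carrier}
    {K : 𝒟.minus.Carrier →L[ℂ] 𝒟.plus.Carrier} {D : 𝒟.minus.Carrier →L[ℂ] 𝒟.minus.Carrier} :
    RepresentedWithK 𝒟 S A K D ↔ BlockRep 𝒟.plus 𝒟.minus S A K D :=
  ⟨fun ⟨a, b, c, d, e⟩ => ⟨a, b, c, d, e⟩, fun ⟨a, b, c, d, e⟩ => ⟨a, b, c, d, e⟩⟩

/-- Exchanging the summands turns the matrix of (ii) into that of (i), with `K = L*` and the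
diagonal blocks swapped. -/
theorem representedWithL_iff {A : 𝒟.plus.Carrier →L[ℂ] 𝒟.plus.Carrier}
    {L : 𝒟.minus.Carrier →L[ℂ] 𝒟.plus.Carrier} {D : 𝒟.minus.Carrier →L[ℂ] 𝒟.minus.Carrier} :
    RepresentedWithL 𝒟 S A L D ↔
      BlockRep 𝒟.minus 𝒟.plus S D (ContinuousLinearMap.adjoint L) A := by
  have hL : ContinuousLinearMap.adjoint (ContinuousLinearMap.adjoint L) = L :=
    ContinuousLinearMap.adjoint_adjoint L
  have hn : ‖ContinuousLinearMap.adjoint L‖ = ‖L‖ := LinearIsometryEquiv.norm_map _ _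
  constructor
  · rintro ⟨a, b, c, d, e⟩
    refine ⟨fun x y => ?_, b, by rwa [hn], d, by rwa [hL]⟩
    rw [add_comm, a, hL, add_comm, add_comm (A y), neg_add_eq_sub]
  · rintro ⟨a, b, c, d, e⟩
    refine ⟨fun x y => ?_, b, by rwa [hn] at c, d, by rwa [hL] at e⟩
    rw [add_comm, a, hL, add_comm, add_comm (A x), neg_add_eq_sub]

end

end Krein

end

theorem theorem5p2 {H : Type*} [NormedAddCommGroup H] [InnerProductSpace ℂ H] [CompleteSpace H]
    (J : Krein.FundamentalSymmetry H) {ι : Type*} (f : ι → H) (hf : Krein.IsJFrame J f)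
    (S : H →L[ℂ] H) (hS : Krein.IsJFrameOperator J f S) :
    -- the inverse of `S`, the decompositions and the angular operators exist
    IsUnit S ∧
    (∃ (𝒟 : Krein.FundamentalDecomposition J) (K : 𝒟.minus.Carrier →L[ℂ] 𝒟.plus.Carrier),
      Krein.IsAngularK f S 𝒟 K) ∧
    (∃ (𝒟 : Krein.FundamentalDecomposition J) (L : 𝒟.minus.Carrier →L[ℂ] 𝒟.plus.Carrier),
      Krein.IsAngularL f S 𝒟 L) ∧
    -- enclosure in terms of `K`
    (∀ (𝒟 : Krein.FundamentalDecomposition J) (K : 𝒟.minus.Carrier →L[ℂ] 𝒟.plus.Carrier),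
      Krein.IsAngularK f S 𝒟 K →
      ∀ αm βm γp δp : ℝ, Krein.IsJFrameBoundsNeg J f αm βm → Krein.IsDualBoundsPos J f S γp δp →
        spectrum ℂ S \ Set.range ((↑) : ℝ → ℂ) ⊆
          Krein.discUnion ‖K‖ δp⁻¹ γp⁻¹ ∩ Krein.discUnion' ‖K‖ αm βm ∧
        Krein.discUnion ‖K‖ δp⁻¹ γp⁻¹ ∩ Krein.discUnion' ‖K‖ αm βm ⊆
          Krein.sector (Real.arcsin ‖K‖)) ∧
    -- enclosure in terms of `L`
    (∀ (𝒟 : Krein.FundamentalDecomposition J) (L : 𝒟.minus.Carrier →L[ℂ] 𝒟.plus.Carrier),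
      Krein.IsAngularL f S 𝒟 L →
      ∀ αp βp γm δm : ℝ, Krein.IsJFrameBoundsPos J f αp βp → Krein.IsDualBoundsNeg J f S γm δm →
        spectrum ℂ S \ Set.range ((↑) : ℝ → ℂ) ⊆
          Krein.discUnion ‖L‖ δm⁻¹ γm⁻¹ ∩ Krein.discUnion' ‖L‖ αp βp ∧
        Krein.discUnion ‖L‖ δm⁻¹ γm⁻¹ ∩ Krein.discUnion' ‖L‖ αp βp ⊆
          Krein.sector (Real.arcsin ‖L‖)) := by
  have hpos := hf.splitFrame_pos hS
  have hneg := hf.splitFrame_neg hS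
  obtain ⟨A, K, D, hK⟩ := hpos.exists_blockRep (P := (hf.decompositionNeg hS).plus)
    (N := (hf.decompositionNeg hS).minus) rfl rfl rfl
  obtain ⟨D', L', A', hL⟩ := hneg.exists_blockRep (P := (hf.decompositionPos hS).minus)
    (N := (hf.decompositionPos hS).plus) (neg_neg 1).symm rfl rfl
  refine ⟨hpos.isUnit rfl rfl hK, ⟨hf.decompositionNeg hS, K, rfl, rfl, A, D,
    Krein.representedWithK_iff.mpr hK⟩, ⟨hf.decompositionPos hS,
    ContinuousLinearMap.adjoint L', rfl, rfl, A', D', Krein.representedWithL_iff.mpr ?_⟩, ?_, ?_⟩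
  · rwa [ContinuousLinearMap.adjoint_adjoint]
  · rintro 𝒟 K ⟨hP, hN, A, D, hrep⟩ αm βm γp δp hb hd
    refine ⟨hpos.spectrum_subset rfl hP hN (Krein.representedWithK_iff.mp hrep) hb.1.1 hb.2.1
      hd.1.1 hd.2.1, Set.inter_subset_left.trans ?_⟩
    -- The first union of discs already lies in the sector, its centres being at least `δp⁻¹ > 0`.
    exact Krein.discUnion_subset_sector (norm_nonneg K) hrep.norm_lt_one (inv_pos.mpr hd.2.1.1)
  · rintro 𝒟 L ⟨hN, hP, A, D, hrep⟩ αp βp γm δm hb hd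
    refine ⟨?_, Set.inter_subset_left.trans ?_⟩
    · have h := hneg.spectrum_subset (neg_neg 1).symm hP hN (Krein.representedWithL_iff.mp hrep)
        hb.1.1 hb.2.1 hd.1.1 hd.2.1
      rwa [LinearIsometryEquiv.norm_map] at h
    · exact Krein.discUnion_subset_sector (norm_nonneg L) hrep.norm_lt_one (inv_pos.mpr hd.2.1.1)
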